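/- Let $K$ be a number field, $N\ge 0$, and let $C=\sum_{i=0}^{N}P_i$ be a zero-cycle on $\mathbb P^N$, defined over $K$, where $P_0,\dots,P_N\in\mathbb P^N(\overline K)$ are $N+1$ (distinct) points in general linear position, i.e. represented by linearly independent column vectors. Put $d=N+1$ and let $z=\sum_{|\alpha|=d}z_\alpha x_\alpha\in K[x_0,\dots,x_N]$ be a Chow form of $C$, i.e. a scalar multiple $\ne0$ of $\prod_i\langle P_i,x\rangle$; it is a point of $Y=\mathbb P(\mathrm{Sym}^d)$, on which $g\in \mathrm{SL}_{N+1}$ acts by $P_i\mapsto gP_i$. Let $s\in H^0(Y,\mathcal O_Y(m))$, $m>0$, be an $\mathrm{SL}_{N+1}$-invariant section over $K$ with $s(z)\neq0$. For a finite place $v$ of $K$ and a form $f$ of degree $d$ over $\overline{K_v}$ put $\|s\|_v(f)=|s(f)|_v/\max_\alpha|f_\alpha|_v^m$, where $|\cdot|_v$ extends the normalized absolute value of $K_v$; for an archimedean $v$ and a form $f$ over $\mathbb C$ let $\|s\|_v(f)$ be given by the Chow metric $$\log\|s\|_v(f)=\log|s(f)|-m\Big(\tfrac d2\sum_{j=1}^N\tfrac1j+\int_{S(\mathbb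 C^{N+1})}\log|f(x)|\,dx\Big),$$ where $dx$ is the rotation invariant probability measure on the unit sphere and $s$ is carried to $\mathbb C$ by an embedding of $K$ belonging to $v$. Let $$\hat h(C)=\frac1{[K:\mathbb Q]}\sum_{v}\epsilon_v\inf_{g\in \mathrm{SL}_{N+1}(\overline{K_v})}\frac{-\log\|s\|_v(g\cdot z)}{m},$$ where $\epsilon_v=2$ if $v$ is complex and $\epsilon_v=1$ otherwise. Then $C$ is Chow semistable, i.e. such $m$ and $s$ exist, and for every such $m$ and $s$: all the infima are finite, only finitely many of them are nonzero, and $\hat h(C)=0$. Moreover, for every embedding $\sigma:\overline K\to\mathbb C$, an element $g\in\mathrm{SL}_{N+1}(\mathbb C)$ minimizes the contribution $g\mapsto-\log\|s\|_v(g\cdot z)/m$ of the archimedean place $v$ given by $\sigma|_K$ if and only if the $N+1$ column vectors $g\,\sigma(P_0),\dots,g\,\sigma(P_N)$ are pairwise orthogonal for the standard Hermitian inner product. -/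

import Mathlib

open MeasureTheory
open scoped LinearAlgebra.Projectivization NumberField

noncomputable section

namespace ChowHeight

/-- The indices `α = (α₀, …, α_N)`, `|α| = d`, of the homogeneous coordinates `z_α` on
`Y = ℙ(Sym^d V)`, `dim V = N + 1`. A point of `Y` over a field `R` is represented by a nonzero
homogeneous polynomial `∑ z_α x_α` of degree `d` over `R`, where `x_α` is the monomial of exponent
`α`. -/
abbrev MultiIndex (N d : ℕ) : Type := {α : Fin (N + 1) →₀ ℕ // α.degree = d}

/-- The linear form `⟨p, x⟩ = ∑ j, p_j x_j` attached to a vector `p`. -/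
def linForm {R : Type*} [CommRing R] {N : ℕ} (p : Fin (N + 1) → R) :
    MvPolynomial (Fin (N + 1)) R :=
  ∑ j, MvPolynomial.C (p j) * MvPolynomial.X j

/-- The Chow form `∏ i, ⟨P_i, x⟩` of the zero-cycle `∑ i, P_i` of degree `d` on `ℙ^N`; it is
well defined up to a nonzero scalar, and here the chosen representatives of the points are used. -/
def chowForm {F : Type*} [Field F] {N d : ℕ} (P : Fin d → ℙ F (Fin (N + 1) → F)) :
    MvPolynomial (Fin (N + 1)) F :=
  ∏ i, linForm (P i).rep

/-- `z` gives homogeneous coordinates in `K` of the Chow point of the cycle `∑ i, P_i`, whose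
points have coordinates in the algebraic closure of `K`. The cycle is defined over `K` exactly when
such a `z` exists (the single points need not be rational over `K`). -/
def IsChowPoint {K : Type*} [Field K] {N d : ℕ}
    (P : Fin d → ℙ (AlgebraicClosure K) (Fin (N + 1) → AlgebraicClosure K))
    (z : MvPolynomial (Fin (N + 1)) K) : Prop :=
  ∃ c : AlgebraicClosure K, c ≠ 0 ∧
    MvPolynomial.map (algebraMap K (AlgebraicClosure K)) z = MvPolynomial.C c * chowForm P

/-- The action of a matrix `g` on forms that is induced by `p ↦ g p` on vectors: it is the
substitution `x ↦ gᵀ x`, hence sends `⟨p, x⟩` to `⟨g p, x⟩` and is compatible with products. -/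
def act {R : Type*} [CommRing R] {N : ℕ} (g : Matrix (Fin (N + 1)) (Fin (N + 1)) R)
    (f : MvPolynomial (Fin (N + 1)) R) : MvPolynomial (Fin (N + 1)) R :=
  MvPolynomial.aeval (fun j => ∑ i, MvPolynomial.C (g i j) * MvPolynomial.X i) f

theorem act_linForm {R : Type*} [CommRing R] {N : ℕ}
    (g : Matrix (Fin (N + 1)) (Fin (N + 1)) R) (p : Fin (N + 1) → R) :
    act g (linForm p) = linForm (g.mulVec p) := by
  simp only [act, linForm, map_sum, map_mul, MvPolynomial.aeval_X, MvPolynomial.aeval_C,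
    MvPolynomial.algebraMap_eq, Matrix.mulVec, dotProduct, Finset.mul_sum, Finset.sum_mul]
  rw [Finset.sum_comm]
  refine Finset.sum_congr rfl fun i _ => Finset.sum_congr rfl fun j _ => ?_
  ring

/-- The value `s(f)` of a polynomial `s` over `K` in the coordinates `z_α` at a form `f` over an
extension `φ : K → L`. The sections of `𝒪_Y(m)` over `K` are the homogeneous `s` of degree `m`. -/
def evalSection {K L : Type*} [CommRing K] [CommRing L] (φ : K →+* L) {N d : ℕ}
    (s : MvPolynomial (MultiIndex N d) K) (f : MvPolynomial (Fin (N + 1)) L) : L :=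
  MvPolynomial.eval₂ φ (fun α => f.coeff α.1) s

/-- Invariance of a section under the group `SL(V)`, on points over the algebraic closure. -/
def IsInvariant {K : Type*} [Field K] {N d : ℕ} (s : MvPolynomial (MultiIndex N d) K) : Prop :=
  ∀ (g : Matrix.SpecialLinearGroup (Fin (N + 1)) (AlgebraicClosure K))
    (f : MvPolynomial (Fin (N + 1)) (AlgebraicClosure K)), f.IsHomogeneous d →
    evalSection (algebraMap K (AlgebraicClosure K)) s (act g.1 f) =
      evalSection (algebraMap K (AlgebraicClosure K)) s f

/-- `s` is an `SL(V)`-invariant section over `K` of `𝒪_Y(m)`, `m > 0`, with `s(z) ≠ 0`. -/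
structure IsAdmissible {K : Type*} [Field K] {N d : ℕ} (z : MvPolynomial (Fin (N + 1)) K)
    (m : ℕ) (s : MvPolynomial (MultiIndex N d) K) : Prop where
  pos : 0 < m
  homogeneous : s.IsHomogeneous m
  invariant : IsInvariant s
  ne_zero : evalSection (RingHom.id K) s z ≠ 0

/-- Chow semistability of the point `z` of `Y = ℙ(Sym^d V)`. (As `𝒪_Y(1)` is ample on the
projective space `Y`, the locus where a section of `𝒪_Y(m)`, `m > 0`, does not vanish is always
affine.) -/
def IsSemistable {K : Type*} [Field K] {N : ℕ} (d : ℕ) (z : MvPolynomial (Fin (N + 1)) K) : Prop :=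
  ∃ (m : ℕ) (s : MvPolynomial (MultiIndex N d) K), IsAdmissible z m s

section Finite

variable {K : Type*} [Field K] [NumberField K]

/-- The algebraic closure of the completion of `K` at the finite place `v`. -/
abbrev LocalClosure (v : IsDedekindDomain.HeightOneSpectrum (𝓞 K)) : Type _ :=
  AlgebraicClosure (v.adicCompletion K)

/-- The unique absolute value on the algebraic closure of `K_v` that extends the normalized `v`-adic
absolute value `‖x‖ = (N v) ^ (-v(x))` of `K_v`. -/
def absFinite (v : IsDedekindDomain.HeightOneSpectrum (𝓞 K)) (x : LocalClosure v) : ℝ :=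
  spectralNorm (v.adicCompletion K) (LocalClosure v) x

/-- `log ‖s‖_v` at the form `f`, for a finite place `v` and a section `s` of `𝒪_Y(m)`:
`‖s‖_v(f) = |s(f)|_v / max_α |f_α|_v ^ m`. -/
def logNormFinite (v : IsDedekindDomain.HeightOneSpectrum (𝓞 K)) {N d : ℕ} (m : ℕ)
    (s : MvPolynomial (MultiIndex N d) K) (f : MvPolynomial (Fin (N + 1)) (LocalClosure v)) : ℝ :=
  Real.log (absFinite v (evalSection (algebraMap K (LocalClosure v)) s f) /
    (⨆ α : MultiIndex N d, absFinite v (f.coeff α.1)) ^ m)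

/-- `-log ‖s‖_v(g • z) / m` for a finite place `v`. -/
def termFinite (v : IsDedekindDomain.HeightOneSpectrum (𝓞 K)) {N d : ℕ} (m : ℕ)
    (s : MvPolynomial (MultiIndex N d) K) (z : MvPolynomial (Fin (N + 1)) K)
    (g : Matrix.SpecialLinearGroup (Fin (N + 1)) (LocalClosure v)) : ℝ :=
  -logNormFinite v m s (act g.1 (MvPolynomial.map (algebraMap K (LocalClosure v)) z)) / m

end Finite

section Infinite

/-- The rotation invariant measure on the unit sphere of `ℂ^(N+1)` induced by Lebesgue measure; it
is used only through averages, that is, after normalization to total mass one. -/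
def sphereMeasure (N : ℕ) :
    Measure (Metric.sphere (0 : EuclideanSpace ℂ (Fin (N + 1))) 1) :=
  ((volume : Measure (Fin (N + 1) → ℂ)).map (WithLp.toLp 2)).toSphere

/-- `log ‖s‖_Ch` at the form `f`, for a section `s` of `𝒪_Y(m)` and the `m`-th power of the Chow
metric of `𝒪_Y(1)` for zero-cycles of degree `d`; `s` is carried to `ℂ` by `φ`. -/
def logNormChow {K : Type*} [Field K] (φ : K →+* ℂ) {N d : ℕ} (m : ℕ)
    (s : MvPolynomial (MultiIndex N d) K) (f : MvPolynomial (Fin (N + 1)) ℂ) : ℝ :=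
  Real.log ‖evalSection φ s f‖ -
    m * ((1 / 2 : ℝ) * d * (∑ j ∈ Finset.Icc 1 N, (1 / (j : ℝ))) +
      ⨍ x, Real.log ‖MvPolynomial.eval (fun i => x.1 i) f‖ ∂(sphereMeasure N))

/-- `-log ‖s‖_φ(g • z) / m` for a complex embedding `φ` of `K`. -/
def termInfinite {K : Type*} [Field K] (φ : K →+* ℂ) {N d : ℕ} (m : ℕ)
    (s : MvPolynomial (MultiIndex N d) K) (z : MvPolynomial (Fin (N + 1)) K)
    (g : Matrix.SpecialLinearGroup (Fin (N + 1)) ℂ) : ℝ :=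
  -logNormChow φ m s (act g.1 (MvPolynomial.map φ z)) / m

end Infinite

/-- The GIT height of the cycle with Chow point `z`, computed with the section `s` of `𝒪_Y(m)`. The
absolute values are normalized so that the product formula holds: at a finite place this is built
into `absFinite`, at an infinite place the contribution is weighted by the local degree. -/
def gitHeight {K : Type*} [Field K] [NumberField K] {N d : ℕ} (m : ℕ)
    (s : MvPolynomial (MultiIndex N d) K) (z : MvPolynomial (Fin (N + 1)) K) : ℝ :=
  (Module.finrank ℚ K : ℝ)⁻¹ *
    ((∑ᶠ v : IsDedekindDomain.HeightOneSpectrum (𝓞 K), ⨅ g, termFinite v m s z g) +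
      ∑ v : NumberField.InfinitePlace K, (v.mult : ℝ) * ⨅ g, termInfinite v.embedding m s z g)

/-- The image in `ℂ^(N+1)`, with its Hermitian inner product, of the column vector of a point `p`
under an embedding `σ` followed by a matrix `g`. -/
def imageVector {F : Type*} [Field F] {N : ℕ} (σ : F →+* ℂ)
    (g : Matrix.SpecialLinearGroup (Fin (N + 1)) ℂ) (p : ℙ F (Fin (N + 1) → F)) :
    EuclideanSpace ℂ (Fin (N + 1)) :=
  WithLp.toLp 2 (g.1.mulVec fun j => σ (p.rep j))

end ChowHeight

end

/-!
Let `E = x₀ ⋯ x_N` be the coordinate form and `M` the matrix whose columns represent the points of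
the cycle. A Chow point is `z = c • M E`, so a translate `g z` is `c • (g M) E`. Since the degree of
the forms equals the dimension, an invariant section `s` of degree `m` satisfies
`s(G E) = det(G) ^ m • a` for every matrix `G` over every extension of `K`, where `a = s(E)` lies in
`K` (`IsInvariant.evalSection_act_coordForm`). Hence `s(g z) = (c det M) ^ m a` for all `g` in `SL`,
and minimizing `-log ‖s‖_v (g z) / m` amounts to minimizing the size of `(g M) E` against the fixed
`|det (g M)| = |det M|`.

At every place this is a Hadamard inequality. At a finite place Gauss's lemma says that the maximal
coefficient of `(g M) E`, a product of linear forms, is the product of the maximal entries of the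
columns of `g M`, which is at least `|det M|` (`exists_valuation_det_le_coeff`). At an archimedean
place the average of `log |⟨q, x⟩|` over the sphere is `log ‖q‖ - (1/2) ∑ j ∈ [1, N], 1 / j`; the
harmonic sum cancels against the constant of the Chow metric, and what remains is
`∑ i, log ‖g P_i‖ ≥ log |det M|`, with equality exactly for orthogonal columns
(`norm_det_eq_prod_norm_iff`). The average is computed by comparing Gaussian integrals over `ℂ` and
over `ℂ^(N+1)` in polar coordinates: both are governed by `Γ'/Γ`, at `1` and at `N + 1`
(`average_log_norm_eval_prod_linForm`). In both cases the bound is attained when `g M` is a scalar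
matrix, so the infimum at `v` is `-log |a|_v / m`, and the sum over all places vanishes by the
product formula for `a`.

Semistability requires an invariant with `s(E) ≠ 0`. The nonarchimedean Hadamard inequality, applied
to the valuations of the function field of the matrix space at which the coefficients of `G E` are
integral, shows that the generic determinant is
integral over the coefficients of `G E`: there is a relation
`det(G) ^ r + ∑ j < r, F_j(G E) det(G) ^ j = 0`. Pairing `∑ j < r, F_j(G f) det(G) ^ j` with
`det(G) ^ r` under the apolar pairing in the entries of `G` gives a polynomial in the coefficients
of `f`. It is `SL`-invariant because the adjoint of right multiplication by `h` is right
multiplication by `hᵀ`, which fixes the determinant, and its value at `E` is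
`-⟨det ^ r, det ^ r⟩`, which is nonzero in characteristic zero. One of its homogeneous components is
the required section (`exists_isInvariant_coordForm_ne_zero`).
-/

noncomputable section

namespace ChowHeight

open MvPolynomial

/-! ### The action of matrices on forms -/

section Action

variable {R S : Type*} [CommRing R] [CommRing S] {N d : ℕ}

/-- The form `x₀ ⋯ x_N`, the Chow form of the sum of the coordinate points. -/
def coordForm (R : Type*) [CommRing R] (N : ℕ) : MvPolynomial (Fin (N + 1)) R := ∏ i, X i

@[simp]
theorem act_X (g : Matrix (Fin (N + 1)) (Fin (N + 1)) R) (j : Fin (N + 1)) :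
    act g (X j) = linForm (fun i => g i j) := by
  simp [act, linForm]

theorem act_mul (g : Matrix (Fin (N + 1)) (Fin (N + 1)) R) (f f' : MvPolynomial (Fin (N + 1)) R) :
    act g (f * f') = act g f * act g f' := by
  simp [act]

@[simp]
theorem act_C (g : Matrix (Fin (N + 1)) (Fin (N + 1)) R) (c : R) : act g (C c) = C c := by
  simp [act, MvPolynomial.algebraMap_eq]

theorem act_C_mul (g : Matrix (Fin (N + 1)) (Fin (N + 1)) R) (c : R)
    (f : MvPolynomial (Fin (N + 1)) R) : act g (C c * f) = C c * act g f := by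
  rw [act_mul, act_C]

theorem act_act (g h : Matrix (Fin (N + 1)) (Fin (N + 1)) R) (f : MvPolynomial (Fin (N + 1)) R) :
    act g (act h f) = act (g * h) f := by
  induction f using MvPolynomial.induction_on with
  | C c => simp
  | add p q hp hq => simp only [act, map_add] at hp hq ⊢; rw [hp, hq]
  | mul_X p j hp =>
    rw [act_mul, act_mul, act_mul, hp, act_X, act_X, act_linForm]
    rfl

@[simp]
theorem act_one (f : MvPolynomial (Fin (N + 1)) R) :
    act (1 : Matrix (Fin (N + 1)) (Fin (N + 1)) R) f = f := by
  have hX (j : Fin (N + 1)) :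
      ∑ i, C ((1 : Matrix (Fin (N + 1)) (Fin (N + 1)) R) i j) * X i = X j := by
    simp [Matrix.one_apply]
  simp [act, hX]

theorem act_coordForm (g : Matrix (Fin (N + 1)) (Fin (N + 1)) R) :
    act g (coordForm R N) = ∏ j, linForm (fun i => g i j) := by
  simp only [act, coordForm, map_prod]
  exact Finset.prod_congr rfl fun j _ => act_X g j

theorem map_linForm (φ : R →+* S) (p : Fin (N + 1) → R) :
    map φ (linForm p) = linForm (fun i => φ (p i)) := by
  simp [linForm]

theorem map_act (φ : R →+* S) (g : Matrix (Fin (N + 1)) (Fin (N + 1)) R)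
    (f : MvPolynomial (Fin (N + 1)) R) : map φ (act g f) = act (g.map φ) (map φ f) := by
  induction f using MvPolynomial.induction_on with
  | C c => simp
  | add p q hp hq => simp only [act, map_add] at hp hq ⊢; rw [hp, hq]
  | mul_X p j hp =>
    rw [act_mul, map_mul, map_mul, act_mul, hp, act_X, map_X, act_X, map_linForm]
    rfl

@[simp]
theorem map_coordForm (φ : R →+* S) : map φ (coordForm R N) = coordForm S N := by
  simp [coordForm]

theorem isHomogeneous_linForm (p : Fin (N + 1) → R) : (linForm p).IsHomogeneous 1 :=
  IsHomogeneous.sum _ _ _ fun j _ => by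
    simpa using (isHomogeneous_C (Fin (N + 1)) (p j)).mul (isHomogeneous_X R j)

theorem isHomogeneous_act (g : Matrix (Fin (N + 1)) (Fin (N + 1)) R)
    {f : MvPolynomial (Fin (N + 1)) R} (hf : f.IsHomogeneous d) : (act g f).IsHomogeneous d := by
  have := hf.aeval (fun j => ∑ i, C (g i j) * X i) (n := 1)
    fun j => isHomogeneous_linForm (fun i => g i j)
  rwa [one_mul] at this

theorem isHomogeneous_coordForm : (coordForm R N).IsHomogeneous (N + 1) := by
  simpa [coordForm] using IsHomogeneous.prod Finset.univ
    (fun i : Fin (N + 1) => (X i : MvPolynomial _ R)) (fun _ => 1) fun i _ => isHomogeneous_X R i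

theorem eval_linForm (p x : Fin (N + 1) → R) : eval x (linForm p) = ∑ j, p j * x j := by
  simp [linForm]

/-- Scalar matrices act by the power of the scalar given by the degree. -/
theorem act_smul_of_isHomogeneous (c : R) (g : Matrix (Fin (N + 1)) (Fin (N + 1)) R)
    {f : MvPolynomial (Fin (N + 1)) R} (hf : f.IsHomogeneous d) :
    act (c • g) f = C (c ^ d) * act g f := by
  have key (m : Fin (N + 1) →₀ ℕ) (hm : m.degree = d) (b : R) :
      act (c • g) (monomial m b) = C (c ^ d) * act g (monomial m b) := by
    subst hm
    simp only [act, aeval_monomial, MvPolynomial.algebraMap_eq, Finsupp.degree_apply,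
      Matrix.smul_apply, smul_eq_mul, map_mul, mul_assoc, ← Finset.mul_sum, Finsupp.prod, mul_pow,
      Finset.prod_mul_distrib, map_pow, Finset.prod_pow_eq_pow_sum]
    ring
  rw [f.as_sum]
  simp only [act, map_sum, Finset.mul_sum] at key ⊢
  refine Finset.sum_congr rfl fun m hm => key m ?_ _
  exact ((hf.degree_eq_sum_deg_support hm).symm)

end Action

/-! ### Evaluation of sections -/

section Evaluation

variable {K L L' : Type*} [CommRing K] [CommRing L] [CommRing L'] {N d : ℕ}

theorem map_evalSection (φ : K →+* L) (ψ : L →+* L') (s : MvPolynomial (MultiIndex N d) K)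
    (f : MvPolynomial (Fin (N + 1)) L) :
    ψ (evalSection φ s f) = evalSection (ψ.comp φ) s (map ψ f) := by
  simp only [evalSection, coeff_map]
  exact hom_eval₂ s φ ψ _

theorem evalSection_C_mul (φ : K →+* L) {s : MvPolynomial (MultiIndex N d) K} {m : ℕ}
    (hs : s.IsHomogeneous m) (c : L) (f : MvPolynomial (Fin (N + 1)) L) :
    evalSection φ s (C c * f) = c ^ m * evalSection φ s f := by
  simp only [evalSection, coeff_C_mul, eval₂_eq, Finset.mul_sum]
  refine Finset.sum_congr rfl fun α hα => ?_
  have : ∑ i ∈ α.support, α i = m := (hs.degree_eq_sum_deg_support hα).symm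
  rw [← this]
  simp only [mul_pow, Finset.prod_mul_distrib, Finset.prod_pow_eq_pow_sum]
  ring

end Evaluation

/-! ### Invariant sections at transforms of the coordinate form -/

section Invariance

variable {K : Type*} [Field K] {N : ℕ}

/-- An invariant section of degree `m` is transformed by an arbitrary matrix over the algebraic
closure through the `m`-th power of the determinant: the degree of the forms is the dimension, so
a scalar matrix contributes the same power on both sides. -/
theorem IsInvariant.evalSection_act {s : MvPolynomial (MultiIndex N (N + 1)) K} {m : ℕ}
    (hs : s.IsHomogeneous m) (hinv : IsInvariant s)
    (g : Matrix (Fin (N + 1)) (Fin (N + 1)) (AlgebraicClosure K)) (hg : g.det ≠ 0)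
    {f : MvPolynomial (Fin (N + 1)) (AlgebraicClosure K)} (hf : f.IsHomogeneous (N + 1)) :
    evalSection (algebraMap K (AlgebraicClosure K)) s (act g f) =
      g.det ^ m * evalSection (algebraMap K (AlgebraicClosure K)) s f := by
  -- `g` is a scalar `δ` times a matrix of determinant one
  obtain ⟨δ, hδ⟩ := IsAlgClosed.exists_pow_nat_eq g.det (Nat.succ_pos N)
  have hδ0 : δ ≠ 0 := by
    rintro rfl
    exact hg (by rw [← hδ]; simp)
  have hdet : (δ⁻¹ • g).det = 1 := by
    rw [Matrix.det_smul, Fintype.card_fin, inv_pow, hδ, inv_mul_cancel₀ hg]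
  have hsplit : g = δ • (δ⁻¹ • g) := by rw [smul_smul, mul_inv_cancel₀ hδ0, one_smul]
  conv_lhs => rw [hsplit]
  rw [act_smul_of_isHomogeneous _ _ hf, evalSection_C_mul _ hs, hδ]
  congr 1
  exact hinv ⟨δ⁻¹ • g, hdet⟩ f hf

/-- The matrix with independent indeterminates as entries. -/
def genericMatrix (K : Type*) [CommRing K] (N : ℕ) :
    Matrix (Fin (N + 1)) (Fin (N + 1)) (MvPolynomial (Fin (N + 1) × Fin (N + 1)) K) :=
  Matrix.mvPolynomialX _ _ K

theorem eval₂_genericMatrix_det {F : Type*} [CommRing F] (ψ : K →+* F)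
    (h : Matrix (Fin (N + 1)) (Fin (N + 1)) F) :
    eval₂ ψ (fun ij => h ij.1 ij.2) (genericMatrix K N).det = h.det := by
  rw [← coe_eval₂Hom, RingHom.map_det]
  congr 1
  ext i j
  simp [genericMatrix]

theorem eval₂_evalSection_genericMatrix {d : ℕ} (s : MvPolynomial (MultiIndex N d) K) {F : Type*}
    [CommRing F] (ψ : K →+* F) (h : Matrix (Fin (N + 1)) (Fin (N + 1)) F)
    (f : MvPolynomial (Fin (N + 1)) K) :
    eval₂ ψ (fun ij => h ij.1 ij.2) (evalSection C s (act (genericMatrix K N) (map C f))) =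
      evalSection ψ s (act h (map ψ f)) := by
  have hG : (genericMatrix K N).map (eval₂Hom ψ (fun ij => h ij.1 ij.2)) = h := by
    ext i j
    simp [genericMatrix]
  have hC : (eval₂Hom ψ (fun ij : Fin (N + 1) × Fin (N + 1) => h ij.1 ij.2)).comp C = ψ := by
    ext x
    simp
  rw [← coe_eval₂Hom, map_evalSection, map_act, hG, map_map, hC]

/-- Specialization of the generic matrix in the polynomial whose vanishing expresses the
transformation law of `s`. -/
theorem eval₂_evalSection_sub_det_pow (s : MvPolynomial (MultiIndex N (N + 1)) K) (m : ℕ) (a : K)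
    {F : Type*} [CommRing F] (ψ : K →+* F) (h : Matrix (Fin (N + 1)) (Fin (N + 1)) F) :
    eval₂ ψ (fun ij => h ij.1 ij.2)
        (evalSection C s (act (genericMatrix K N) (coordForm _ N)) -
          (genericMatrix K N).det ^ m * C a) =
      evalSection ψ s (act h (coordForm F N)) - h.det ^ m * ψ a := by
  have := eval₂_evalSection_genericMatrix s ψ h (coordForm K N)
  simp only [map_coordForm] at this
  rw [eval₂_sub, eval₂_mul, eval₂_pow, eval₂_C, eval₂_genericMatrix_det, this]

/-- The value of an invariant section at the transform of the coordinate simplex by any matrix over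
any extension of the base field; the identity is one of polynomials in the entries of the matrix
and holds because it holds at all invertible matrices over the algebraic closure. -/
theorem IsInvariant.evalSection_act_coordForm {s : MvPolynomial (MultiIndex N (N + 1)) K} {m : ℕ}
    (hs : s.IsHomogeneous m) (hinv : IsInvariant s) {L : Type*} [CommRing L] (φ : K →+* L)
    (g : Matrix (Fin (N + 1)) (Fin (N + 1)) L) :
    evalSection φ s (act g (coordForm L N)) =
      g.det ^ m * φ (evalSection (RingHom.id K) s (coordForm K N)) := by
  set a := evalSection (RingHom.id K) s (coordForm K N) with ha
  let G := genericMatrix K N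
  let Q : MvPolynomial (Fin (N + 1) × Fin (N + 1)) K :=
    evalSection C s (act G (coordForm _ N)) - G.det ^ m * C a
  -- the factor `G.det` disposes of the singular matrices
  have hzero : map (algebraMap K (AlgebraicClosure K)) (G.det * Q) = 0 := by
    refine MvPolynomial.funext fun x => ?_
    let h : Matrix (Fin (N + 1)) (Fin (N + 1)) (AlgebraicClosure K) := .of fun i j => x (i, j)
    have hdet := eval₂_genericMatrix_det (algebraMap K (AlgebraicClosure K)) h
    rw [eval_map, map_zero, eval₂_mul]
    by_cases hd : h.det = 0
    · exact mul_eq_zero_of_left (hdet.trans hd) _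
    · refine mul_eq_zero_of_right _ ((eval₂_evalSection_sub_det_pow s m a _ h).trans ?_)
      rw [hinv.evalSection_act hs h hd isHomogeneous_coordForm, ha, map_evalSection]
      simp
  have hQ : Q = 0 := by
    rw [← map_zero (map (algebraMap K (AlgebraicClosure K)))] at hzero
    have := map_injective _ (algebraMap K (AlgebraicClosure K)).injective hzero
    exact (mul_eq_zero.mp this).resolve_left (Matrix.det_mvPolynomialX_ne_zero _ K)
  have := eval₂_evalSection_sub_det_pow s m a φ g
  change eval₂ _ _ Q = _ at this
  rw [hQ, eval₂_zero] at this
  exact sub_eq_zero.mp this.symm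

end Invariance

/-! ### Chow points of independent points -/

section ChowPoint

variable {K : Type*} [Field K] {N : ℕ}

/-- The matrix whose columns represent the points of the cycle. -/
def pointMatrix {F : Type*} [Field F] {N : ℕ} (P : Fin (N + 1) → ℙ F (Fin (N + 1) → F)) :
    Matrix (Fin (N + 1)) (Fin (N + 1)) F :=
  .of fun i j => (P j).rep i

theorem det_pointMatrix_ne_zero {F : Type*} [Field F] {P : Fin (N + 1) → ℙ F (Fin (N + 1) → F)}
    (hP : Projectivization.Independent P) : (pointMatrix P).det ≠ 0 := by
  rw [Projectivization.independent_iff] at hP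
  have : LinearIndependent F (pointMatrix P).col := hP
  exact ((Matrix.isUnit_iff_isUnit_det _).mp
    (Matrix.linearIndependent_cols_iff_isUnit.mp this)).ne_zero

theorem chowForm_eq_act {F : Type*} [Field F] (P : Fin (N + 1) → ℙ F (Fin (N + 1) → F)) :
    chowForm P = act (pointMatrix P) (coordForm F N) := by
  rw [act_coordForm]
  rfl

/-- Over an extension `L` of the algebraic closure of `K`, the transform by `g` of a Chow point is,
up to the scalar `c`, a transform of the coordinate form. -/
theorem act_map_of_isChowPoint {P : Fin (N + 1) → ℙ (AlgebraicClosure K) (Fin (N + 1) → _)}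
    {z : MvPolynomial (Fin (N + 1)) K} {c : AlgebraicClosure K}
    (hz : map (algebraMap K (AlgebraicClosure K)) z = C c * chowForm P)
    {L : Type*} [CommRing L] {φ : K →+* L} {τ : AlgebraicClosure K →+* L}
    (hτ : τ.comp (algebraMap K (AlgebraicClosure K)) = φ)
    (g : Matrix (Fin (N + 1)) (Fin (N + 1)) L) :
    act g (map φ z) = C (τ c) * act (g * (pointMatrix P).map τ) (coordForm L N) := by
  rw [← hτ, ← map_map, hz, map_mul, map_C, chowForm_eq_act, map_act, map_coordForm, act_C_mul,
    act_act]

/-- An invariant section has the same value at all transforms of a Chow point. -/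
theorem IsInvariant.evalSection_act_chowPoint
    {P : Fin (N + 1) → ℙ (AlgebraicClosure K) (Fin (N + 1) → _)}
    {z : MvPolynomial (Fin (N + 1)) K} {c : AlgebraicClosure K}
    (hz : map (algebraMap K (AlgebraicClosure K)) z = C c * chowForm P)
    {s : MvPolynomial (MultiIndex N (N + 1)) K} {m : ℕ}
    (hs : s.IsHomogeneous m) (hinv : IsInvariant s)
    {L : Type*} [CommRing L] {φ : K →+* L} {τ : AlgebraicClosure K →+* L}
    (hτ : τ.comp (algebraMap K (AlgebraicClosure K)) = φ)
    (g : Matrix.SpecialLinearGroup (Fin (N + 1)) L) :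
    evalSection φ s (act g.1 (map φ z)) =
      (τ c * τ (pointMatrix P).det) ^ m * φ (evalSection (RingHom.id K) s (coordForm K N)) := by
  rw [act_map_of_isChowPoint hz hτ, evalSection_C_mul _ hs, hinv.evalSection_act_coordForm hs,
    Matrix.det_mul, g.2, one_mul, mul_pow, RingHom.map_det, mul_assoc]
  rfl

/-- An invariant section vanishes at a Chow point exactly when it vanishes at the coordinate
form. -/
theorem IsInvariant.evalSection_chowPoint_ne_zero_iff
    {P : Fin (N + 1) → ℙ (AlgebraicClosure K) (Fin (N + 1) → _)}
    (hP : Projectivization.Independent P)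
    {z : MvPolynomial (Fin (N + 1)) K} (hz : IsChowPoint P z)
    {s : MvPolynomial (MultiIndex N (N + 1)) K} {m : ℕ}
    (hs : s.IsHomogeneous m) (hinv : IsInvariant s) :
    evalSection (RingHom.id K) s z ≠ 0 ↔ evalSection (RingHom.id K) s (coordForm K N) ≠ 0 := by
  obtain ⟨c, hc, hz⟩ := hz
  have key := hinv.evalSection_act_chowPoint hz hs
    (φ := algebraMap K (AlgebraicClosure K)) (RingHom.id_comp _) 1
  have hmap := map_evalSection (RingHom.id K) (algebraMap K (AlgebraicClosure K)) s z
  rw [Matrix.SpecialLinearGroup.coe_one, act_one] at key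
  rw [RingHom.comp_id, key] at hmap
  have hfactor : (c * (pointMatrix P).det) ^ m ≠ 0 :=
    pow_ne_zero _ (mul_ne_zero hc (det_pointMatrix_ne_zero hP))
  rw [← map_ne_zero (algebraMap K (AlgebraicClosure K)), hmap]
  exact (mul_ne_zero_iff_left hfactor).trans (map_ne_zero _)

/-- Over an algebraically closed extension some element of `SL` moves the cycle to the sum of the
coordinate points. -/
theorem exists_mul_pointMatrix_eq_smul_one
    {P : Fin (N + 1) → ℙ (AlgebraicClosure K) (Fin (N + 1) → _)}
    (hP : Projectivization.Independent P) {L : Type*} [Field L] [IsAlgClosed L]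
    (τ : AlgebraicClosure K →+* L) :
    ∃ (g : Matrix.SpecialLinearGroup (Fin (N + 1)) L) (δ : L),
      δ ^ (N + 1) = τ (pointMatrix P).det ∧ g.1 * (pointMatrix P).map τ = δ • 1 := by
  obtain ⟨δ, hδ⟩ := IsAlgClosed.exists_pow_nat_eq (τ (pointMatrix P).det) (Nat.succ_pos N)
  have hdet : ((pointMatrix P).map τ).det = τ (pointMatrix P).det := (τ.map_det _).symm
  have h0 : τ (pointMatrix P).det ≠ 0 := by
    simpa using det_pointMatrix_ne_zero hP
  refine ⟨⟨δ • ((pointMatrix P).map τ)⁻¹, ?_⟩, δ, hδ, ?_⟩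
  · rw [Matrix.det_smul, Fintype.card_fin, Matrix.det_nonsing_inv, hdet, hδ,
      Ring.mul_inverse_cancel _ h0.isUnit]
  · rw [Matrix.smul_mul, Matrix.nonsing_inv_mul _ (by rw [hdet]; exact h0.isUnit)]

end ChowPoint

/-! ### Gauss's lemma and the nonarchimedean Hadamard inequality -/

section Gauss

variable {N : ℕ}

theorem coeff_linForm {R : Type*} [CommRing R] (p : Fin (N + 1) → R) (i : Fin (N + 1)) :
    coeff (Finsupp.single i 1) (linForm p) = p i := by
  classical
  simp [linForm, coeff_sum, coeff_C_mul, coeff_X, Finsupp.single_left_inj]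

theorem linForm_smul {R : Type*} [CommRing R] (c : R) (p : Fin (N + 1) → R) :
    linForm (c • p) = C c * linForm p := by
  simp [linForm, Finset.mul_sum, mul_assoc]

/-- Gauss's lemma for linear forms: a product of primitive linear forms over a local ring is
primitive, since the polynomial ring over the residue field is a domain. -/
theorem exists_isUnit_coeff_prod_linForm {A : Type*} [CommRing A] [IsLocalRing A]
    {q : Fin (N + 1) → Fin (N + 1) → A} (hq : ∀ j, ∃ i, IsUnit (q j i)) :
    ∃ α, IsUnit (coeff α (∏ j, linForm (q j))) := by
  have hne : map (IsLocalRing.residue A) (∏ j, linForm (q j)) ≠ 0 := by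
    rw [map_prod, Finset.prod_ne_zero_iff]
    intro j _ h
    obtain ⟨i, hi⟩ := hq j
    rw [map_linForm] at h
    have := congrArg (coeff (Finsupp.single i 1)) h
    rw [coeff_linForm, coeff_zero, IsLocalRing.residue_eq_zero_iff] at this
    exact (IsLocalRing.mem_maximalIdeal _).mp this hi
  obtain ⟨α, hα⟩ := ne_zero_iff.mp hne
  refine ⟨α, ?_⟩
  rw [coeff_map, Ne, IsLocalRing.residue_eq_zero_iff] at hα
  exact not_not.mp hα

/-- The nonarchimedean Hadamard inequality in terms of the product of the linear forms: the
determinant of the coefficients is bounded by some coefficient of the product, because the maximal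
coefficient of the product is the product of the maximal coefficients. -/
theorem exists_valuation_det_le_coeff {F Γ : Type*} [Field F] [LinearOrderedCommGroupWithZero Γ]
    (v : Valuation F Γ) (p : Matrix (Fin (N + 1)) (Fin (N + 1)) F) (hp : p.det ≠ 0) :
    ∃ α : MultiIndex N (N + 1), v p.det ≤ v (coeff α.1 (act p (coordForm F N))) := by
  -- dividing every column by an entry of maximal value makes the linear forms primitive
  have hmax (j : Fin (N + 1)) : ∃ i, ∀ k, v (p k j) ≤ v (p i j) := Finite.exists_max _
  choose i hi using hmax
  have hne (j : Fin (N + 1)) : p (i j) j ≠ 0 := by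
    intro h
    refine hp (Matrix.det_eq_zero_of_column_eq_zero j fun k => ?_)
    have := hi j k
    rwa [h, map_zero, le_zero_iff, map_eq_zero] at this
  have hmem (j k : Fin (N + 1)) : (p (i j) j)⁻¹ * p k j ∈ v.valuationSubring := by
    rw [Valuation.mem_valuationSubring_iff, map_mul, map_inv₀]
    exact inv_mul_le_one_of_le₀ (hi j k) zero_le
  let q : Fin (N + 1) → Fin (N + 1) → v.valuationSubring := fun j k => ⟨_, hmem j k⟩
  obtain ⟨α, u, hu⟩ := exists_isUnit_coeff_prod_linForm (q := q) fun j => ⟨i j, by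
    have : q j (i j) = 1 := Subtype.ext (inv_mul_cancel₀ (hne j))
    rw [this]
    exact isUnit_one⟩
  have hfac : act p (coordForm F N) =
      C (∏ j, p (i j) j) * map v.valuationSubring.subtype (∏ j, linForm (q j)) := by
    rw [act_coordForm, map_prod, map_prod, ← Finset.prod_mul_distrib]
    refine Finset.prod_congr rfl fun j _ => ?_
    rw [map_linForm, ← linForm_smul]
    congr 1
    ext k
    exact (mul_inv_cancel_left₀ (hne j) _).symm
  have hcoeff : coeff α (act p (coordForm F N)) = (∏ j, p (i j) j) * (u : v.valuationSubring) := by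
    rw [hfac, coeff_C_mul, coeff_map, hu]
    rfl
  have hu1 : v ((u : v.valuationSubring) : F) = 1 := by
    refine le_antisymm (u : v.valuationSubring).2 ?_
    have h2 : v (((u⁻¹ : (v.valuationSubring)ˣ) : v.valuationSubring) : F) ≤ 1 :=
      ((u⁻¹ : (v.valuationSubring)ˣ) : v.valuationSubring).2
    have h3 : ((u : v.valuationSubring) : F) *
        (((u⁻¹ : (v.valuationSubring)ˣ) : v.valuationSubring) : F) = 1 := by
      exact_mod_cast congrArg Subtype.val u.mul_inv
    have h4 := congrArg v h3
    rw [map_mul, map_one] at h4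
    rw [← h4]
    exact mul_le_of_le_one_right' h2
  have hdeg : α.degree = N + 1 := by
    by_contra h
    have h0 := (isHomogeneous_act p isHomogeneous_coordForm).coeff_eq_zero h
    have : v (coeff α (act p (coordForm F N))) ≠ 0 := by
      rw [hcoeff, map_mul, hu1, mul_one, Ne, map_eq_zero]
      exact Finset.prod_ne_zero_iff.mpr fun j _ => hne j
    exact this (by rw [h0, map_zero])
  refine ⟨⟨α, hdeg⟩, ?_⟩
  simp only
  rw [hcoeff, map_mul, hu1, mul_one, map_prod, Matrix.det_apply]
  refine v.map_sum_le fun σ _ => ?_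
  have hsign : v ((Equiv.Perm.sign σ : ℤ) : F) = 1 := by
    rcases Int.units_eq_one_or (Equiv.Perm.sign σ) with h | h <;> simp [h]
  rw [Units.smul_def, zsmul_eq_mul, map_mul, hsign, one_mul, map_prod]
  exact Finset.prod_le_prod' fun j _ => hi j (σ j)

end Gauss

/-! ### Integrality of the determinant over the coefficients of a Chow form -/

section Integrality

variable (K : Type*) [Field K] (N : ℕ)

/-- The determinant of the generic matrix is integral over the coefficients of the product of the
generic linear forms. By the valuative criterion for integrality, this is the content of
`exists_valuation_det_le_coeff`. -/
theorem exists_det_genericMatrix_pow_add_sum_eq_zero :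
    ∃ (r : ℕ) (F : ℕ → MvPolynomial (MultiIndex N (N + 1)) K),
      (genericMatrix K N).det ^ r + ∑ j ∈ Finset.range r,
        evalSection C (F j) (act (genericMatrix K N) (coordForm _ N)) *
          (genericMatrix K N).det ^ j = 0 := by
  let A := MvPolynomial (Fin (N + 1) × Fin (N + 1)) K
  let Fr := FractionRing A
  let ι : A →+* Fr := algebraMap A Fr
  have hι : Function.Injective ι := IsFractionRing.injective A Fr
  let G := genericMatrix K N
  let ev : MvPolynomial (MultiIndex N (N + 1)) K →+* A :=
    eval₂Hom C fun α => coeff α.1 (act G (coordForm A N))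
  let S : Set Fr := Set.range (ι.comp ev)
  have hint : ι G.det ∈ (integralClosure (Subring.closure S) Fr).toSubring := by
    rw [← iInf_valuationSubring_superset, Subring.mem_iInf]
    rintro ⟨V, hV⟩
    have hdet0 : (G.map ι).det ≠ 0 := by
      rw [← RingHom.mapMatrix_apply, ← RingHom.map_det, Ne, map_eq_zero_iff ι hι]
      exact Matrix.det_mvPolynomialX_ne_zero _ K
    obtain ⟨α, hα⟩ := exists_valuation_det_le_coeff V.valuation (G.map ι) hdet0
    have hmem : coeff α.1 (act (G.map ι) (coordForm Fr N)) ∈ V := by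
      refine hV ⟨X α, ?_⟩
      rw [← map_coordForm ι, ← map_act, coeff_map]
      simp [ev]
    rw [← RingHom.mapMatrix_apply, ← RingHom.map_det] at hα
    exact V.mem_of_valuation_le_one _ (hα.trans ((V.valuation_le_one_iff _).mpr hmem))
  -- elements of the ring generated by the coefficients are values of polynomials over `K`
  have hclosure (x : Subring.closure S) : ∃ F, ι (ev F) = x := by
    have : Subring.closure S ≤ (ι.comp ev).range :=
      Subring.closure_le.mpr fun y hy => hy
    exact this x.2
  choose lift hlift using hclosure
  obtain ⟨p, hp, hroot⟩ := hint
  refine ⟨p.natDegree, fun j => lift (p.coeff j), hι ?_⟩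
  rw [Polynomial.eval₂_eq_sum_range, Finset.sum_range_succ, hp.coeff_natDegree, map_one,
    one_mul] at hroot
  rw [map_zero, map_add, map_sum, ← hroot, add_comm, map_pow]
  congr 1
  refine Finset.sum_congr rfl fun j _ => ?_
  rw [map_mul, map_pow]
  congr 1
  exact hlift (p.coeff j)

end Integrality

/-! ### The apolar pairing -/

section Apolar

variable {R S σ : Type*} [CommRing R] [CommRing S]

/-- The product of the factorials of the exponents of a monomial. -/
def monomialFactorial (α : σ →₀ ℕ) : ℕ := α.prod fun _ k => k.factorial

/-- The apolar (Bombieri) pairing `⟨p, q⟩ = ∑ α, α! p_α q_α`, that is, the constant term of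
`p(∂) q`. -/
def apolar (p q : MvPolynomial σ R) : R :=
  ∑ α ∈ p.support, (monomialFactorial α : R) * (coeff α p * coeff α q)

theorem apolar_eq_sum {p : MvPolynomial σ R} (q : MvPolynomial σ R) {s : Finset (σ →₀ ℕ)}
    (hs : p.support ⊆ s) :
    apolar p q = ∑ α ∈ s, (monomialFactorial α : R) * (coeff α p * coeff α q) := by
  refine Finset.sum_subset hs fun α _ hα => ?_
  rw [notMem_support_iff.mp hα, zero_mul, mul_zero]

theorem apolar_add_left (p p' q : MvPolynomial σ R) :
    apolar (p + p') q = apolar p q + apolar p' q := by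
  classical
  rw [apolar_eq_sum q (support_add (p := p) (q := p')),
    apolar_eq_sum q (Finset.subset_union_left (s₁ := p.support) (s₂ := p'.support)),
    apolar_eq_sum q (Finset.subset_union_right (s₁ := p.support) (s₂ := p'.support)),
    ← Finset.sum_add_distrib]
  refine Finset.sum_congr rfl fun α _ => ?_
  rw [coeff_add]
  ring

theorem apolar_add_right (p q q' : MvPolynomial σ R) :
    apolar p (q + q') = apolar p q + apolar p q' := by
  simp only [apolar, coeff_add, mul_add, Finset.sum_add_distrib]

theorem apolar_sum_left {ι : Type*} (s : Finset ι) (p : ι → MvPolynomial σ R)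
    (q : MvPolynomial σ R) : apolar (∑ i ∈ s, p i) q = ∑ i ∈ s, apolar (p i) q :=
  map_sum (AddMonoidHom.mk' (fun p => apolar p q) fun p p' => apolar_add_left p p' q) p s

theorem apolar_sum_right {ι : Type*} (s : Finset ι) (p : MvPolynomial σ R)
    (q : ι → MvPolynomial σ R) : apolar p (∑ i ∈ s, q i) = ∑ i ∈ s, apolar p (q i) :=
  map_sum (AddMonoidHom.mk' (apolar p) (apolar_add_right p)) q s

theorem apolar_C_mul_left (c : R) (p q : MvPolynomial σ R) :
    apolar (C c * p) q = c * apolar p q := by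
  have hs : (C c * p).support ⊆ p.support := fun α hα => by
    rw [mem_support_iff, coeff_C_mul] at hα
    exact mem_support_iff.mpr (right_ne_zero_of_mul hα)
  rw [apolar_eq_sum q hs, apolar, Finset.mul_sum]
  refine Finset.sum_congr rfl fun α _ => ?_
  rw [coeff_C_mul]
  ring

theorem apolar_C_mul_right (c : R) (p q : MvPolynomial σ R) :
    apolar p (C c * q) = c * apolar p q := by
  rw [apolar, apolar, Finset.mul_sum]
  refine Finset.sum_congr rfl fun α _ => ?_
  rw [coeff_C_mul]
  ring

theorem apolar_monomial (α : σ →₀ ℕ) (c : R) (q : MvPolynomial σ R) :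
    apolar (monomial α c) q = monomialFactorial α * (c * coeff α q) := by
  classical
  rw [apolar_eq_sum q support_monomial_subset, Finset.sum_singleton, coeff_monomial, if_pos rfl]

theorem apolar_C (c : R) (q : MvPolynomial σ R) : apolar (C c) q = c * coeff 0 q := by
  rw [← monomial_zero', apolar_monomial]
  simp [monomialFactorial]

theorem map_apolar (φ : R →+* S) (p q : MvPolynomial σ R) :
    φ (apolar p q) = apolar (map φ p) (map φ q) := by
  rw [apolar_eq_sum (map φ q) (support_map_subset φ p), apolar, map_sum]
  simp [coeff_map]

theorem apolar_eq_zero_of_isHomogeneous {p q : MvPolynomial σ R} {a b : ℕ}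
    (hp : p.IsHomogeneous a) (hq : q.IsHomogeneous b) (hab : a ≠ b) : apolar p q = 0 := by
  refine Finset.sum_eq_zero fun α hα => ?_
  rw [hq.coeff_eq_zero (d := α) (by rw [Finsupp.degree_apply,
    ← hp.degree_eq_sum_deg_support hα]; exact hab), mul_zero, mul_zero]

/-- Multiplication by a variable is adjoint to the partial derivative. -/
theorem apolar_X_mul (i : σ) (p q : MvPolynomial σ R) :
    apolar (X i * p) q = apolar p (pderiv i q) := by
  induction p using MvPolynomial.induction_on' with
  | add p p' hp hp' => rw [mul_add, apolar_add_left, apolar_add_left, hp, hp']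
  | monomial α c =>
    rw [mul_comm, X, monomial_mul, mul_one, apolar_monomial, apolar_monomial, coeff_pderiv]
    have : monomialFactorial (α + Finsupp.single i 1) = monomialFactorial α * (α i + 1) := by
      classical
      unfold monomialFactorial
      set T := insert i α.support
      have h1 : (α + Finsupp.single i 1).support ⊆ T := by
        intro j hj
        by_contra hjT
        simp only [T, Finset.mem_insert, not_or, Finsupp.mem_support_iff, not_not] at hjT
        simp [hjT.2, Ne.symm hjT.1] at hj
      have h2 : α.support ⊆ T := Finset.subset_insert _ _
      rw [Finsupp.prod_of_support_subset _ h1 _ (by simp),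
        Finsupp.prod_of_support_subset _ h2 _ (by simp),
        ← Finset.mul_prod_erase T _ (Finset.mem_insert_self i _),
        ← Finset.mul_prod_erase T (fun j => (α j).factorial) (Finset.mem_insert_self i _)]
      have h3 : ∏ j ∈ T.erase i, ((α + Finsupp.single i 1 : σ →₀ ℕ) j).factorial =
          ∏ j ∈ T.erase i, (α j).factorial := by
        refine Finset.prod_congr rfl fun j hj => ?_
        simp [(Finset.ne_of_mem_erase hj)]
      rw [h3]
      simp only [Finsupp.add_apply, Finsupp.single_eq_same, Nat.factorial_succ]
      ring
    rw [this]
    push_cast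
    ring

variable [Fintype σ]

/-- The linear substitution `X_s ↦ ∑ t, A s t X_t`. -/
def linSubst (A : Matrix σ σ R) : MvPolynomial σ R →ₐ[R] MvPolynomial σ R :=
  aeval fun s => ∑ t, C (A s t) * X t

theorem pderiv_linSubst (A : Matrix σ σ R) (i : σ) (q : MvPolynomial σ R) :
    pderiv i (linSubst A q) = ∑ j, C (A j i) * linSubst A (pderiv j q) := by
  classical
  induction q using MvPolynomial.induction_on with
  | C c => simp [linSubst, MvPolynomial.algebraMap_eq]
  | add p q hp hq => simp only [map_add, hp, hq, mul_add, Finset.sum_add_distrib]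
  | mul_X p k hp =>
    have hX : pderiv i (linSubst A (X k)) = C (A k i) := by
      simp only [linSubst, aeval_X, map_sum, pderiv_C_mul, pderiv_X]
      simp [Pi.single_apply]
    rw [map_mul, pderiv_mul, hp, hX]
    simp only [pderiv_mul, map_add, map_mul, pderiv_X, mul_add, Finset.sum_add_distrib,
      Finset.sum_mul]
    congr 1
    · exact Finset.sum_congr rfl fun j _ => by ring
    · rw [Finset.sum_eq_single k]
      · simp [mul_comm]
      · intro j _ hj
        simp [Ne.symm hj]
      · simp

/-- The adjoint of a linear substitution is the substitution of the transposed matrix. -/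
theorem apolar_linSubst (A : Matrix σ σ R) (p q : MvPolynomial σ R) :
    apolar (linSubst A p) q = apolar p (linSubst A.transpose q) := by
  induction p using MvPolynomial.induction_on generalizing q with
  | C c =>
    have h0 (B : Matrix σ σ R) (q : MvPolynomial σ R) : coeff 0 (linSubst B q) = coeff 0 q := by
      change constantCoeff (linSubst B q) = constantCoeff q
      induction q using MvPolynomial.induction_on with
      | C c => simp [linSubst, MvPolynomial.algebraMap_eq]
      | add p q hp hq => simp only [map_add, hp, hq]
      | mul_X p k hp => simp [linSubst]
    have : linSubst A (C c) = C c := by simp [linSubst, MvPolynomial.algebraMap_eq]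
    rw [this, apolar_C, apolar_C, h0]
  | add p p' hp hp' => rw [map_add, apolar_add_left, apolar_add_left, hp, hp']
  | mul_X p k hp =>
    have hX : linSubst A (X k) = ∑ t, C (A k t) * X t := by simp [linSubst]
    rw [map_mul, hX, Finset.mul_sum, apolar_sum_left, mul_comm p, apolar_X_mul, pderiv_linSubst,
      apolar_sum_right]
    refine Finset.sum_congr rfl fun t _ => ?_
    rw [mul_left_comm, apolar_C_mul_left, apolar_C_mul_right, mul_comm _ (X t), apolar_X_mul, hp,
      Matrix.transpose_apply]

end Apolar

/-! ### The generic determinant -/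

section RightMultiplication

variable {R : Type*} [CommRing R] {N : ℕ}

/-- The matrix, in the standard basis, of right multiplication of square matrices by `h`. -/
def rightMulMatrix (h : Matrix (Fin (N + 1)) (Fin (N + 1)) R) :
    Matrix (Fin (N + 1) × Fin (N + 1)) (Fin (N + 1) × Fin (N + 1)) R :=
  .of fun a b => if a.1 = b.1 then h b.2 a.2 else 0

theorem transpose_rightMulMatrix (h : Matrix (Fin (N + 1)) (Fin (N + 1)) R) :
    (rightMulMatrix h).transpose = rightMulMatrix h.transpose := by
  ext a b
  simp only [rightMulMatrix, Matrix.transpose_apply, Matrix.of_apply, eq_comm]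

/-- Substitution of `G h` for the generic matrix `G`. -/
def rightMulSubst (h : Matrix (Fin (N + 1)) (Fin (N + 1)) R) :
    MvPolynomial (Fin (N + 1) × Fin (N + 1)) R →ₐ[R]
      MvPolynomial (Fin (N + 1) × Fin (N + 1)) R :=
  linSubst (rightMulMatrix h)

theorem apolar_rightMulSubst (h : Matrix (Fin (N + 1)) (Fin (N + 1)) R)
    (p q : MvPolynomial (Fin (N + 1) × Fin (N + 1)) R) :
    apolar p (rightMulSubst h q) = apolar (rightMulSubst h.transpose p) q := by
  rw [rightMulSubst, rightMulSubst, apolar_linSubst, transpose_rightMulMatrix,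
    Matrix.transpose_transpose]

theorem rightMulSubst_genericMatrix (h : Matrix (Fin (N + 1)) (Fin (N + 1)) R) :
    (genericMatrix R N).map (rightMulSubst h) = genericMatrix R N * h.map C := by
  ext1 i j
  rw [Matrix.map_apply, Matrix.mul_apply]
  simp only [genericMatrix, Matrix.mvPolynomialX_apply, rightMulSubst, linSubst,
    rightMulMatrix, aeval_X, Matrix.of_apply, Fintype.sum_prod_type, Matrix.map_apply]
  rw [Finset.sum_eq_single i]
  · simp [mul_comm]
  · intro k _ hk
    simp [Ne.symm hk]
  · simp

theorem rightMulSubst_genericMatrix_det (h : Matrix (Fin (N + 1)) (Fin (N + 1)) R)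
    (hh : h.det = 1) : rightMulSubst h (genericMatrix R N).det = (genericMatrix R N).det := by
  rw [AlgHom.map_det, AlgHom.mapMatrix_apply, rightMulSubst_genericMatrix, Matrix.det_mul,
    ← RingHom.mapMatrix_apply, ← RingHom.map_det, hh, map_one, mul_one]

theorem isHomogeneous_det_of_isHomogeneous_one {σ n : Type*} [Fintype n] [DecidableEq n]
    {A : Matrix n n (MvPolynomial σ R)} (hA : ∀ i j, (A i j).IsHomogeneous 1) :
    A.det.IsHomogeneous (Fintype.card n) := by
  rw [Matrix.det_apply]
  refine IsHomogeneous.sum _ _ _ fun τ _ => ?_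
  have hprod : (∏ i, A (τ i) i).IsHomogeneous (∑ _i : n, 1) :=
    IsHomogeneous.prod Finset.univ _ (fun _ => 1) fun i _ => hA _ _
  rw [Finset.sum_const, Finset.card_univ, smul_eq_mul, mul_one] at hprod
  rcases Int.units_eq_one_or (Equiv.Perm.sign τ) with h | h
  · rw [h, one_smul]
    exact hprod
  · rw [h, Units.neg_smul, one_smul]
    exact hprod.neg

theorem isHomogeneous_genericMatrix_det : (genericMatrix R N).det.IsHomogeneous (N + 1) := by
  have := isHomogeneous_det_of_isHomogeneous_one (A := genericMatrix R N)
    fun i j => isHomogeneous_X R (i, j)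
  rwa [Fintype.card_fin] at this

theorem map_genericMatrix_det {S : Type*} [CommRing S] (φ : R →+* S) :
    map φ (genericMatrix R N).det = (genericMatrix S N).det := by
  rw [RingHom.map_det]
  congr 1
  ext1 i j
  simp [genericMatrix]

/-- The apolar pairing is positive definite over `ℚ`, so a power of the determinant is not apolar
to itself in characteristic zero. -/
theorem apolar_det_pow_self_ne_zero (K : Type*) [Field K] [CharZero K] (N r : ℕ) :
    apolar ((genericMatrix K N).det ^ r) ((genericMatrix K N).det ^ r) ≠ 0 := by
  have hmap : (genericMatrix K N).det ^ r =
      map (algebraMap ℚ K) ((genericMatrix ℚ N).det ^ r) := by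
    rw [map_pow, map_genericMatrix_det]
  rw [hmap, ← map_apolar, Ne, map_eq_zero]
  have hne : (genericMatrix ℚ N).det ^ r ≠ 0 := pow_ne_zero _ (Matrix.det_mvPolynomialX_ne_zero _ ℚ)
  refine ne_of_gt (Finset.sum_pos (fun α hα => ?_) (support_nonempty.mpr hne))
  refine mul_pos ?_ (mul_self_pos.mpr (mem_support_iff.mp hα))
  exact_mod_cast Finset.prod_pos fun i _ => Nat.factorial_pos _

end RightMultiplication

/-! ### Homogeneous components of invariant polynomials -/

section HomogeneousComponents

variable {K L : Type*} [CommRing K] [CommRing L] {N d : ℕ}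

theorem evalSection_eq_sum_homogeneousComponent (φ : K →+* L) (s : MvPolynomial (MultiIndex N d) K)
    (f : MvPolynomial (Fin (N + 1)) L) :
    evalSection φ s f =
      ∑ i ∈ Finset.range (s.totalDegree + 1), evalSection φ (homogeneousComponent i s) f := by
  conv_lhs => rw [← sum_homogeneousComponent s]
  exact eval₂_sum φ _ _ _

/-- The homogeneous components of an invariant polynomial are invariant, because the group action
commutes with the scaling of forms. -/
theorem IsInvariant.homogeneousComponent {K : Type*} [Field K]
    {s : MvPolynomial (MultiIndex N d) K} (hs : IsInvariant s) (i : ℕ) :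
    IsInvariant (MvPolynomial.homogeneousComponent i s) := by
  intro g f hf
  set φ := algebraMap K (AlgebraicClosure K)
  by_cases hi : i < s.totalDegree + 1
  swap
  · rw [homogeneousComponent_eq_zero i s (by omega)]
    simp [evalSection]
  -- by invariance under scaling, the polynomial with the defects `e k` as coefficients vanishes
  -- at every `t`
  let e : ℕ → AlgebraicClosure K := fun k =>
    evalSection φ (MvPolynomial.homogeneousComponent k s) (act g.1 f) -
      evalSection φ (MvPolynomial.homogeneousComponent k s) f
  let p : Polynomial (AlgebraicClosure K) :=
    ∑ k ∈ Finset.range (s.totalDegree + 1), Polynomial.C (e k) * Polynomial.X ^ k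
  have hp : p = 0 := by
    refine Polynomial.funext fun t => ?_
    have hinv := hs g (C t * f) (hf.C_mul t)
    rw [act_C_mul, evalSection_eq_sum_homogeneousComponent φ s (C t * act g.1 f),
      evalSection_eq_sum_homogeneousComponent φ s (C t * f), ← sub_eq_zero,
      ← Finset.sum_sub_distrib] at hinv
    rw [Polynomial.eval_zero, ← hinv, Polynomial.eval_finsetSum]
    refine Finset.sum_congr rfl fun k _ => ?_
    rw [evalSection_C_mul φ (homogeneousComponent_isHomogeneous k s),
      evalSection_C_mul φ (homogeneousComponent_isHomogeneous k s)]
    simp [e]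
    ring
  have hcoeff : p.coeff i = e i := by
    simp [p, Polynomial.coeff_X_pow]
    omega
  rw [hp, Polynomial.coeff_zero] at hcoeff
  exact sub_eq_zero.mp hcoeff.symm

end HomogeneousComponents

/-! ### The generic form -/

section GenericForm

variable {K L : Type*} [CommRing K] [CommRing L] {N d : ℕ}

instance : Finite (MultiIndex N d) := (Finsupp.finite_of_degree_eq d).to_subtype

variable (K N d) in
/-- The form of degree `d` whose coefficients are the coordinates of `Y`. -/
def genericForm : MvPolynomial (Fin (N + 1)) (MvPolynomial (MultiIndex N d) K) :=
  letI := Fintype.ofFinite (MultiIndex N d)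
  ∑ α : MultiIndex N d, monomial α.1 (X α)

theorem map_genericForm (φ : K →+* L) {f : MvPolynomial (Fin (N + 1)) L}
    (hf : f.IsHomogeneous d) :
    map (eval₂Hom φ fun α : MultiIndex N d => coeff α.1 f) (genericForm K N d) = f := by
  classical
  let := Fintype.ofFinite (MultiIndex N d)
  ext β
  simp only [genericForm, map_sum, map_monomial, coe_eval₂Hom, eval₂_X, coeff_sum, coeff_monomial]
  by_cases hβ : β.degree = d
  · rw [Finset.sum_eq_single ⟨β, hβ⟩]
    · simp
    · intro α _ hα
      rw [if_neg fun h => hα (Subtype.ext h)]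
    · simp
  · rw [hf.coeff_eq_zero hβ]
    exact Finset.sum_eq_zero fun α _ => if_neg fun h : α.1 = β => hβ (h ▸ α.2)

end GenericForm

/-! ### Cayley's averaging process -/

section Averaging

variable {K L L' : Type*} [CommRing K] [CommRing L] [CommRing L'] {N d : ℕ}

/-- Cayley's averaging process: the apolar pairing of a power of the generic determinant with
polynomials in the generic translate of the form `f`. It depends polynomially on `f` and is
invariant under `SL`. -/
def detPairing (φ : K →+* L) (r : ℕ) (F : ℕ → MvPolynomial (MultiIndex N d) K)
    (f : MvPolynomial (Fin (N + 1)) L) : L :=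
  apolar ((genericMatrix L N).det ^ r)
    (∑ j ∈ Finset.range r, evalSection (C.comp φ) (F j) (act (genericMatrix L N) (map C f)) *
      (genericMatrix L N).det ^ j)

theorem map_detPairing (φ : K →+* L) (ψ : L →+* L') (r : ℕ)
    (F : ℕ → MvPolynomial (MultiIndex N d) K) (f : MvPolynomial (Fin (N + 1)) L) :
    ψ (detPairing φ r F f) = detPairing (ψ.comp φ) r F (map ψ f) := by
  have hG : (genericMatrix L N).map (map ψ) = genericMatrix L' N := by
    ext1 i j
    simp [genericMatrix]
  have hC : (map ψ).comp (C : L →+* MvPolynomial (Fin (N + 1) × Fin (N + 1)) L) = C.comp ψ := by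
    ext1 x
    simp
  rw [detPairing, map_apolar, map_pow, map_genericMatrix_det, map_sum, detPairing]
  congr 1
  refine Finset.sum_congr rfl fun j _ => ?_
  rw [map_mul, map_pow, map_genericMatrix_det, map_evalSection, map_act, hG, map_map, map_map,
    ← RingHom.comp_assoc, hC, RingHom.comp_assoc]

theorem map_evalSection_act {A : Type*} [CommRing A] (φ : K →+* L) (ι : L →+* A) (ρ : A →+* A)
    (hρ : ρ.comp ι = ι) (G : Matrix (Fin (N + 1)) (Fin (N + 1)) A)
    (h : Matrix (Fin (N + 1)) (Fin (N + 1)) L) (hG : G.map ρ = G * h.map ι)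
    (s : MvPolynomial (MultiIndex N d) K) (f : MvPolynomial (Fin (N + 1)) L) :
    ρ (evalSection (ι.comp φ) s (act G (map ι f))) =
      evalSection (ι.comp φ) s (act G (map ι (act h f))) := by
  rw [map_evalSection, map_act, map_map, ← RingHom.comp_assoc, hρ, map_act, act_act, hG]

theorem detPairing_act (φ : K →+* L) (r : ℕ) (F : ℕ → MvPolynomial (MultiIndex N d) K)
    (f : MvPolynomial (Fin (N + 1)) L) (h : Matrix (Fin (N + 1)) (Fin (N + 1)) L)
    (hh : h.det = 1) : detPairing φ r F (act h f) = detPairing φ r F f := by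
  have hC : (rightMulSubst h).toRingHom.comp C = C :=
    RingHom.ext fun x => (rightMulSubst h).commutes x
  have hev (j : ℕ) :
      evalSection (C.comp φ) (F j) (act (genericMatrix L N) (map C (act h f))) =
        rightMulSubst h (evalSection (C.comp φ) (F j) (act (genericMatrix L N) (map C f))) :=
    (map_evalSection_act φ C (rightMulSubst h).toRingHom hC (genericMatrix L N) h
      (rightMulSubst_genericMatrix h) (F j) f).symm
  have hdet := rightMulSubst_genericMatrix_det h hh
  have hdet' := rightMulSubst_genericMatrix_det h.transpose (by rw [Matrix.det_transpose, hh])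
  have hW : (∑ j ∈ Finset.range r,
        evalSection (C.comp φ) (F j) (act (genericMatrix L N) (map C (act h f))) *
          (genericMatrix L N).det ^ j) =
      rightMulSubst h (∑ j ∈ Finset.range r,
        evalSection (C.comp φ) (F j) (act (genericMatrix L N) (map C f)) *
          (genericMatrix L N).det ^ j) := by
    rw [map_sum]
    refine Finset.sum_congr rfl fun j _ => ?_
    rw [hev, map_mul, map_pow, hdet]
  rw [detPairing, hW, apolar_rightMulSubst, map_pow, hdet', detPairing]

theorem detPairing_zero (φ : K →+* L) (r : ℕ) (F : ℕ → MvPolynomial (MultiIndex N d) K) :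
    detPairing φ r F 0 = 0 := by
  rw [detPairing, apolar_sum_right]
  refine Finset.sum_eq_zero fun j hj => ?_
  have h0 : evalSection (C.comp φ) (F j)
      (act (genericMatrix L N) (map C (0 : MvPolynomial (Fin (N + 1)) L))) =
        C (evalSection φ (F j) 0) := by
    rw [map_evalSection]
    congr 1
    simp [act]
  -- `det ^ r` and `det ^ j` have different degrees, as `j < r`
  rw [h0, apolar_C_mul_right, apolar_eq_zero_of_isHomogeneous
    (isHomogeneous_genericMatrix_det.pow r) (isHomogeneous_genericMatrix_det.pow j), mul_zero]
  have := Finset.mem_range.mp hj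
  exact fun h => this.ne (Nat.eq_of_mul_eq_mul_left (Nat.succ_pos N) h).symm

/-- Pairing with the generic form gives a polynomial in the coordinates of `Y` whose value at `f` is
`detPairing φ r F f`. -/
theorem evalSection_detPairing_genericForm (φ : K →+* L) (r : ℕ)
    (F : ℕ → MvPolynomial (MultiIndex N d) K) {f : MvPolynomial (Fin (N + 1)) L}
    (hf : f.IsHomogeneous d) :
    evalSection φ (detPairing C r F (genericForm K N d)) f = detPairing φ r F f := by
  have hC : (eval₂Hom φ fun α : MultiIndex N d => coeff α.1 f).comp C = φ := by
    ext1 x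
    simp
  have := map_detPairing C (eval₂Hom φ fun α : MultiIndex N d => coeff α.1 f) r F
    (genericForm K N d)
  rwa [hC, map_genericForm φ hf] at this

end Averaging

/-! ### Semistability -/

section Semistability

variable {K : Type*} [Field K] {N : ℕ}

/-- Averaging the integral equation of the determinant produces an invariant section that does not
vanish at the coordinate form. -/
theorem exists_isInvariant_coordForm_ne_zero (K : Type*) [Field K] [CharZero K] (N : ℕ) :
    ∃ (m : ℕ) (s : MvPolynomial (MultiIndex N (N + 1)) K), 0 < m ∧ s.IsHomogeneous m ∧
      IsInvariant s ∧ evalSection (RingHom.id K) s (coordForm K N) ≠ 0 := by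
  obtain ⟨r, F, hF⟩ := exists_det_genericMatrix_pow_add_sum_eq_zero K N
  set s := detPairing C r F (genericForm K N (N + 1)) with hs
  have hinv : IsInvariant s := fun g f hf => by
    rw [hs, evalSection_detPairing_genericForm _ r F hf,
      evalSection_detPairing_genericForm _ r F (isHomogeneous_act g.1 hf),
      detPairing_act _ _ _ _ _ g.2]
  have hne : evalSection (RingHom.id K) s (coordForm K N) ≠ 0 := by
    rw [hs, evalSection_detPairing_genericForm _ r F isHomogeneous_coordForm, detPairing]
    simp only [RingHom.comp_id, map_coordForm]
    rw [eq_neg_of_add_eq_zero_right hF, ← one_mul (_ ^ r), ← neg_mul, one_mul,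
      ← C_1, ← C_neg, apolar_C_mul_right]
    exact mul_ne_zero (neg_ne_zero.mpr one_ne_zero) (apolar_det_pow_self_ne_zero K N r)
  have hzero : evalSection (RingHom.id K) s 0 = 0 := by
    rw [hs, evalSection_detPairing_genericForm _ r F (isHomogeneous_zero _ _ _), detPairing_zero]
  rw [evalSection_eq_sum_homogeneousComponent] at hne
  obtain ⟨m, -, hm⟩ := Finset.exists_ne_zero_of_sum_ne_zero hne
  refine ⟨m, homogeneousComponent m s, Nat.pos_of_ne_zero ?_,
    homogeneousComponent_isHomogeneous m s, hinv.homogeneousComponent m, hm⟩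
  -- the component of degree zero is the constant `s(0) = 0`
  rintro rfl
  refine hm ?_
  rw [homogeneousComponent_zero]
  have h0 : evalSection (RingHom.id K) s 0 = coeff 0 s := by
    simp only [evalSection, coeff_zero]
    exact RingHom.congr_fun eval_zero s
  rw [← h0, hzero]
  simp [evalSection]

/-- A Chow point of a cycle of independent points is semistable. -/
theorem isSemistable_of_isChowPoint [CharZero K]
    {P : Fin (N + 1) → ℙ (AlgebraicClosure K) (Fin (N + 1) → AlgebraicClosure K)}
    (hP : Projectivization.Independent P)
    {z : MvPolynomial (Fin (N + 1)) K} (hz : IsChowPoint P z) : IsSemistable (N + 1) z := by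
  obtain ⟨m, s, hm, hs, hinv, hne⟩ := exists_isInvariant_coordForm_ne_zero K N
  exact ⟨m, s, hm, hs, hinv, (hinv.evalSection_chowPoint_ne_zero_iff hP hz hs).mpr hne⟩

end Semistability

/-! ### Finite places -/

section FinitePlaces

open IsDedekindDomain NumberField

/-- The spectral norm of an algebraic extension of a complete nonarchimedean field is
multiplicative as soon as the absolute value of the field is nontrivial. -/
theorem spectralNorm_mul_of_exists_one_lt_norm {k L : Type*} [NormedField k] [CompleteSpace k]
    [IsUltrametricDist k] [Field L] [Algebra k L] [Algebra.IsAlgebraic k L]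
    (h : ∃ x : k, 1 < ‖x‖) (x y : L) :
    spectralNorm k L (x * y) = spectralNorm k L x * spectralNorm k L y := by
  let : NontriviallyNormedField k := { ‹NormedField k› with non_trivial := h }
  exact spectralAlgNorm_mul (K := k) x y

variable {K : Type*} [Field K] [NumberField K] (v : HeightOneSpectrum (𝓞 K))

theorem exists_one_lt_norm_adicCompletion : ∃ x : v.adicCompletion K, 1 < ‖x‖ := by
  obtain ⟨π, hπ, h0⟩ := v.asIdeal.ne_bot_iff.mp v.ne_bot
  refine ⟨(FinitePlace.embedding v (algebraMap (𝓞 K) K π))⁻¹, ?_⟩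
  rw [norm_inv]
  refine (one_lt_inv₀ ?_).mpr ((FinitePlace.norm_lt_one_iff_mem K v π).mpr hπ)
  rw [norm_pos_iff, Ne, map_eq_zero]
  simpa using h0

/-- The absolute value `absFinite v` as a valuation. -/
def absFiniteValuation : Valuation (LocalClosure v) NNReal where
  toFun x := ⟨absFinite v x, spectralNorm_nonneg x⟩
  map_zero' := Subtype.ext spectralNorm_zero
  map_one' := Subtype.ext spectralNorm_one
  map_mul' x y := Subtype.ext
    (spectralNorm_mul_of_exists_one_lt_norm (exists_one_lt_norm_adicCompletion v) x y)
  map_add_le_max' x y := isNonarchimedean_spectralNorm (K := v.adicCompletion K) x y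

theorem absFinite_eq_valuation (x : LocalClosure v) : absFinite v x = absFiniteValuation v x := rfl

theorem absFinite_mul (x y : LocalClosure v) :
    absFinite v (x * y) = absFinite v x * absFinite v y := by
  simp [absFinite_eq_valuation]

theorem absFinite_pow (x : LocalClosure v) (k : ℕ) : absFinite v (x ^ k) = absFinite v x ^ k := by
  simp [absFinite_eq_valuation]

theorem absFinite_pos {x : LocalClosure v} (hx : x ≠ 0) : 0 < absFinite v x := by
  rw [absFinite_eq_valuation, NNReal.coe_pos, Valuation.pos_iff]
  exact hx

theorem absFinite_algebraMap (a : K) :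
    absFinite v (algebraMap K (LocalClosure v) a) = ‖FinitePlace.embedding v a‖ := by
  rw [absFinite, IsScalarTower.algebraMap_apply K (v.adicCompletion K) (LocalClosure v),
    spectralNorm_extends]
  rfl

variable {N : ℕ}

theorem coordForm_eq_monomial (R : Type*) [CommRing R] :
    coordForm R N = monomial (∑ i, Finsupp.single i 1) 1 := by
  rw [monomial_sum_one]
  rfl

theorem absFinite_coeff_coordForm_le_one (α : Fin (N + 1) →₀ ℕ) :
    absFinite v (coeff α (coordForm (LocalClosure v) N)) ≤ 1 := by
  classical
  rw [coordForm_eq_monomial, coeff_monomial]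
  split_ifs <;> simp [absFinite_eq_valuation]

/-- The contribution of a finite place attains its infimum, at the elements that move the points to
the coordinate points. -/
theorem isLeast_range_termFinite
    {P : Fin (N + 1) → ℙ (AlgebraicClosure K) (Fin (N + 1) → AlgebraicClosure K)}
    (hP : Projectivization.Independent P)
    {z : MvPolynomial (Fin (N + 1)) K} (hz : IsChowPoint P z)
    {m : ℕ} {s : MvPolynomial (MultiIndex N (N + 1)) K} (hm : 0 < m) (hs : s.IsHomogeneous m)
    (hinv : IsInvariant s) (ha : evalSection (RingHom.id K) s (coordForm K N) ≠ 0) :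
    IsLeast (Set.range (termFinite v m s z))
      (-Real.log ‖FinitePlace.embedding v (evalSection (RingHom.id K) s (coordForm K N))‖ / m) := by
  set a := evalSection (RingHom.id K) s (coordForm K N)
  obtain ⟨c, hc, hz⟩ := hz
  let τ : AlgebraicClosure K →+* LocalClosure v :=
    (IsAlgClosed.lift : AlgebraicClosure K →ₐ[K] LocalClosure v).toRingHom
  have hτ : τ.comp (algebraMap K (AlgebraicClosure K)) = algebraMap K (LocalClosure v) :=
    AlgHom.comp_algebraMap _
  -- the lower bound for the maximal coefficient of a translate, and the maximal coefficient `B g`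
  let b := absFinite v (τ c * τ (pointMatrix P).det)
  have hdet : ((pointMatrix P).map τ).det = τ (pointMatrix P).det := (τ.map_det _).symm
  have hdet0 : τ (pointMatrix P).det ≠ 0 := by
    simpa using det_pointMatrix_ne_zero hP
  have hb : 0 < b := absFinite_pos v (mul_ne_zero (by simpa using hc) hdet0)
  have hapos : 0 < ‖FinitePlace.embedding v a‖ := by simpa using ha
  let B (g : Matrix.SpecialLinearGroup (Fin (N + 1)) (LocalClosure v)) : ℝ :=
    ⨆ α : MultiIndex N (N + 1),
      absFinite v (coeff α.1 (act g.1 (map (algebraMap K (LocalClosure v)) z)))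
  have hcoeff (g : Matrix.SpecialLinearGroup (Fin (N + 1)) (LocalClosure v))
      (α : MultiIndex N (N + 1)) :
      absFinite v (coeff α.1 (act g.1 (map (algebraMap K (LocalClosure v)) z))) =
        absFinite v (τ c) *
          absFinite v (coeff α.1 (act (g.1 * (pointMatrix P).map τ) (coordForm _ N))) := by
    rw [act_map_of_isChowPoint hz hτ, coeff_C_mul, absFinite_mul]
  have hbB (g : Matrix.SpecialLinearGroup (Fin (N + 1)) (LocalClosure v)) : b ≤ B g := by
    have hgdet : (g.1 * (pointMatrix P).map τ).det = τ (pointMatrix P).det := by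
      rw [Matrix.det_mul, g.2, one_mul, hdet]
    obtain ⟨α, hα⟩ := exists_valuation_det_le_coeff (absFiniteValuation v)
      (g.1 * (pointMatrix P).map τ) (by rwa [hgdet])
    rw [hgdet, ← NNReal.coe_le_coe, ← absFinite_eq_valuation, ← absFinite_eq_valuation] at hα
    refine le_trans ?_ (le_ciSup (Set.finite_range _).bddAbove α)
    rw [hcoeff]
    simp only [b, absFinite_mul]
    exact mul_le_mul_of_nonneg_left hα (spectralNorm_nonneg _)
  have hterm (g : Matrix.SpecialLinearGroup (Fin (N + 1)) (LocalClosure v)) :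
      termFinite v m s z g =
        -Real.log ‖FinitePlace.embedding v a‖ / m + (Real.log (B g) - Real.log b) := by
    have hB : 0 < B g := hb.trans_le (hbB g)
    have hm' : (m : ℝ) ≠ 0 := by exact_mod_cast hm.ne'
    rw [termFinite, logNormFinite, hinv.evalSection_act_chowPoint hz hs hτ, absFinite_mul,
      absFinite_pow, absFinite_algebraMap]
    change -Real.log (b ^ m * ‖FinitePlace.embedding v a‖ / B g ^ m) / m = _
    rw [Real.log_div (by positivity) (by positivity), Real.log_mul (by positivity) (by positivity),
      Real.log_pow, Real.log_pow]
    field_simp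
    ring
  constructor
  · obtain ⟨g, δ, hδ, hg⟩ := exists_mul_pointMatrix_eq_smul_one hP τ
    refine ⟨g, ?_⟩
    have hBb : B g ≤ b := by
      have : Nonempty (MultiIndex N (N + 1)) :=
        ⟨⟨Finsupp.single 0 (N + 1), Finsupp.degree_single _ _⟩⟩
      refine ciSup_le fun α => ?_
      rw [hcoeff, hg, act_smul_of_isHomogeneous _ _ isHomogeneous_coordForm, coeff_C_mul, hδ,
        act_one, absFinite_mul, ← mul_assoc, ← absFinite_mul]
      exact mul_le_of_le_one_right hb.le (absFinite_coeff_coordForm_le_one v _)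
    rw [hterm, le_antisymm hBb (hbB g), sub_self, add_zero]
  · rintro _ ⟨g, rfl⟩
    rw [hterm]
    have := Real.log_le_log hb (hbB g)
    linarith

end FinitePlaces

/-! ### Gaussian integrals of radial functions and averages over spheres -/

section RadialIntegrals

open Set Real Asymptotics Filter Topology
open scoped Nat

theorem mellinConvergent_log_mul_exp_neg {s : ℂ} (hs : 0 < s.re) :
    MellinConvergent (fun t : ℝ => Real.log t • ((Real.exp (-t) : ℝ) : ℂ)) s := by
  refine (mellin_hasDerivAt_of_isBigO_rpow (E := ℂ) ?_ ?_ (lt_add_one s.re) ?_ hs).1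
  · refine (Continuous.continuousOn ?_).locallyIntegrableOn measurableSet_Ioi
    exact Complex.continuous_ofReal.comp (Real.continuous_exp.comp continuous_neg)
  · rw [← isBigO_norm_left]
    simp_rw [Complex.norm_real, isBigO_norm_left]
    simpa only [neg_one_mul] using (isLittleO_exp_neg_mul_rpow_atTop zero_lt_one _).isBigO
  · simp_rw [neg_zero, rpow_zero]
    refine isBigO_const_of_tendsto (?_ : Tendsto _ _ (𝓝 (1 : ℂ))) one_ne_zero
    rw [(by simp : (1 : ℂ) = Real.exp (-0))]
    exact (Complex.continuous_ofReal.comp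
      (Real.continuous_exp.comp continuous_neg)).continuousWithinAt

theorem cpow_natCast_add_one_sub_one_mul (k : ℕ) (t : ℝ) (x : ℂ) :
    (t : ℂ) ^ ((k : ℂ) + 1 - 1) * x = ((t ^ k : ℝ) : ℂ) * x := by
  rw [add_sub_cancel_right, Complex.cpow_natCast, Complex.ofReal_pow]

theorem integrableOn_pow_mul_log_mul_exp_neg (k : ℕ) :
    IntegrableOn (fun t : ℝ => t ^ k * (Real.log t * Real.exp (-t))) (Ioi 0) := by
  have h := mellinConvergent_log_mul_exp_neg (s := (k : ℂ) + 1) (by simp; positivity)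
  have h2 := h.re
  refine (integrableOn_congr_fun (fun t _ => ?_) measurableSet_Ioi).mp h2
  simp only [smul_eq_mul, Complex.real_smul]
  rw [cpow_natCast_add_one_sub_one_mul, ← Complex.ofReal_mul, ← Complex.ofReal_mul]
  exact Complex.ofReal_re _

theorem integral_pow_mul_log_mul_exp_neg (k : ℕ) :
    ∫ t in Ioi (0 : ℝ), t ^ k * (Real.log t * Real.exp (-t)) =
      k ! * (-eulerMascheroniConstant + harmonic k) := by
  have hre : 0 < ((k : ℂ) + 1).re := by simp; positivity
  have h1 := Complex.hasDerivAt_GammaIntegral hre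
  have h2 : HasDerivAt Complex.GammaIntegral
      (k ! * (-eulerMascheroniConstant + harmonic k)) ((k : ℂ) + 1) := by
    refine (Complex.hasDerivAt_Gamma_nat k).congr_of_eventuallyEq ?_
    have hopen : IsOpen {s : ℂ | 0 < s.re} := Complex.continuous_re.isOpen_preimage _ isOpen_Ioi
    filter_upwards [hopen.mem_nhds hre] with s hs using (Complex.Gamma_eq_integral hs).symm
  have h3 := h1.unique h2
  simp_rw [cpow_natCast_add_one_sub_one_mul] at h3
  have h4 : ∫ t in Ioi (0 : ℝ), ((t ^ k : ℝ) : ℂ) * (Real.log t * Real.exp (-t)) =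
      ((∫ t in Ioi (0 : ℝ), t ^ k * (Real.log t * Real.exp (-t)) : ℝ) : ℂ) := by
    rw [← integral_complex_ofReal]
    simp
  rw [h4] at h3
  exact_mod_cast h3

theorem integrableOn_pow_mul_exp_neg (k : ℕ) :
    IntegrableOn (fun t : ℝ => t ^ k * Real.exp (-t)) (Ioi 0) := by
  have := Real.GammaIntegral_convergent (s := k + 1) (by positivity)
  refine (integrableOn_congr_fun (fun t _ => ?_) measurableSet_Ioi).mp this
  simp [mul_comm]

theorem integral_pow_mul_exp_neg (k : ℕ) :
    ∫ t in Ioi (0 : ℝ), t ^ k * Real.exp (-t) = k ! := by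
  rw [← Real.Gamma_nat_eq_factorial, Real.Gamma_eq_integral (by positivity)]
  refine setIntegral_congr_fun measurableSet_Ioi fun t _ => ?_
  simp [mul_comm]

theorem log_norm_eq {E : Type*} [NormedAddCommGroup E] (x : E) :
    Real.log ‖x‖ = 1 / 2 * Real.log (‖x‖ ^ 2) := by
  rw [Real.log_pow]
  push_cast
  ring

variable {E : Type*} [NormedAddCommGroup E] [NormedSpace ℝ E] [FiniteDimensional ℝ E]
  [MeasurableSpace E] [BorelSpace E] (μ : Measure E) [μ.IsAddHaarMeasure]

theorem integrable_comp_norm_sq_iff [Nontrivial E] {k : ℕ}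
    (hE : Module.finrank ℝ E = 2 * (k + 1)) (g : ℝ → ℝ) :
    Integrable (fun x => g (‖x‖ ^ 2)) μ ↔ IntegrableOn (fun t => t ^ k * g t) (Ioi 0) := by
  rw [integrable_fun_norm_addHaar μ (f := fun y => g (y ^ 2)),
    ← integrableOn_Ioi_comp_rpow_iff' (fun t => t ^ k * g t) two_ne_zero, hE]
  refine integrableOn_congr_fun (fun y _ => ?_) measurableSet_Ioi
  have h1 : 2 * (k + 1) - 1 = 2 * k + 1 := by omega
  have h2 : y ^ ((2 : ℝ) - 1) = y := by norm_num
  simp only [smul_eq_mul, h1, h2, Real.rpow_two]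
  ring

theorem integral_comp_norm_sq [Nontrivial E] {k : ℕ}
    (hE : Module.finrank ℝ E = 2 * (k + 1)) (g : ℝ → ℝ) :
    ∫ x, g (‖x‖ ^ 2) ∂μ =
      (k + 1) * μ.real (Metric.ball 0 1) * ∫ t in Ioi (0 : ℝ), t ^ k * g t := by
  rw [integral_fun_norm_addHaar μ (fun y => g (y ^ 2)),
    ← integral_comp_rpow_Ioi_of_pos (g := fun t => t ^ k * g t) two_pos, hE]
  have h1 : 2 * (k + 1) - 1 = 2 * k + 1 := by omega
  have h2 (y : ℝ) : y ^ ((2 : ℝ) - 1) = y := by norm_num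
  simp only [smul_eq_mul, nsmul_eq_mul, h1, h2, Real.rpow_two]
  rw [show (fun y : ℝ => 2 * y * ((y ^ 2) ^ k * g (y ^ 2))) =
    fun y => 2 * (y ^ (2 * k + 1) * g (y ^ 2)) by ext y; ring, integral_const_mul]
  push_cast
  ring

theorem integrable_exp_neg_norm_sq [Nontrivial E] {k : ℕ}
    (hE : Module.finrank ℝ E = 2 * (k + 1)) :
    Integrable (fun x => Real.exp (-‖x‖ ^ 2)) μ :=
  (integrable_comp_norm_sq_iff μ hE fun t => Real.exp (-t)).mpr (integrableOn_pow_mul_exp_neg k)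

theorem integrable_log_norm_mul_exp_neg_norm_sq [Nontrivial E] {k : ℕ}
    (hE : Module.finrank ℝ E = 2 * (k + 1)) :
    Integrable (fun x => Real.log ‖x‖ * Real.exp (-‖x‖ ^ 2)) μ := by
  simp_rw [log_norm_eq, mul_assoc]
  exact ((integrable_comp_norm_sq_iff μ hE fun t => Real.log t * Real.exp (-t)).mpr
    (integrableOn_pow_mul_log_mul_exp_neg k)).const_mul _

/-- The mean of `log ‖x‖` for the Gaussian weight is half a digamma value at half the dimension. -/
theorem integral_log_norm_mul_exp_neg_norm_sq [Nontrivial E] {k : ℕ}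
    (hE : Module.finrank ℝ E = 2 * (k + 1)) :
    ∫ x, Real.log ‖x‖ * Real.exp (-‖x‖ ^ 2) ∂μ =
      1 / 2 * (-eulerMascheroniConstant + harmonic k) * ∫ x, Real.exp (-‖x‖ ^ 2) ∂μ := by
  simp_rw [log_norm_eq, mul_assoc]
  rw [integral_const_mul, integral_comp_norm_sq μ hE fun t => Real.log t * Real.exp (-t),
    integral_comp_norm_sq μ hE fun t => Real.exp (-t), integral_pow_mul_log_mul_exp_neg,
    integral_pow_mul_exp_neg]
  ring

/-- The average over the unit sphere of a function that is constant on rays is its Gaussian mean. -/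
theorem average_toSphere_eq [Nontrivial E] {k : ℕ} (hE : Module.finrank ℝ E = 2 * (k + 1))
    {h : E → ℝ} (hh : ∀ x (r : ℝ), 0 < r → h (r • x) = h x) :
    (⨍ x, h x.1 ∂μ.toSphere) =
      (∫ x, Real.exp (-‖x‖ ^ 2) ∂μ)⁻¹ * ∫ x, h x * Real.exp (-‖x‖ ^ 2) ∂μ := by
  let ρ := Measure.volumeIoiPow (Module.finrank ℝ E - 1)
  let w : Ioi (0 : ℝ) → ℝ := fun r => Real.exp (-r.1 ^ 2)
  have key (f : E → ℝ) (hf : ∀ x (r : ℝ), 0 < r → f (r • x) = f x) :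
      ∫ x, f x * Real.exp (-‖x‖ ^ 2) ∂μ = (∫ x, f x.1 ∂μ.toSphere) * ∫ r, w r ∂ρ := by
    have hpolar := μ.measurePreserving_homeomorphUnitSphereProd.integral_comp
      (homeomorphUnitSphereProd E).measurableEmbedding (fun p => f p.1 * w p.2)
    have hpunct := integral_subtype_comap (μ := μ) (measurableSet_singleton (0 : E)).compl
      (fun x => f x * Real.exp (-‖x‖ ^ 2))
    rw [restrict_compl_singleton] at hpunct
    rw [← integral_prod_mul (fun x : Metric.sphere (0 : E) 1 => f x.1) w, ← hpolar, ← hpunct]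
    refine integral_congr_ae (Eventually.of_forall fun x => ?_)
    have hx : 0 < ‖x.1‖ := norm_pos_iff.mpr x.2
    simp only [w, homeomorphUnitSphereProd_apply_snd_coe, homeomorphUnitSphereProd_apply_fst_coe]
    rw [hf _ _ (inv_pos.mpr hx)]
  have h1 := key (fun _ => 1) fun _ _ _ => rfl
  simp only [one_mul, integral_const, smul_eq_mul, mul_one] at h1
  have hpos : 0 < ∫ x, Real.exp (-‖x‖ ^ 2) ∂μ := integral_exp_pos (integrable_exp_neg_norm_sq μ hE)
  rw [average_eq, key h hh, h1, smul_eq_mul]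
  rw [h1] at hpos
  have hw : ∫ r, w r ∂ρ ≠ 0 := right_ne_zero_of_mul hpos.ne'
  have hσ : μ.toSphere.real univ ≠ 0 := left_ne_zero_of_mul hpos.ne'
  field_simp

end RadialIntegrals

/-! ### The average of the logarithm of a product of linear forms over the sphere -/

section SphereAverage

open Real

variable {N : ℕ}

/-- Lebesgue measure on `ℂ^(N+1)` with its Euclidean norm. -/
def euclideanVolume (N : ℕ) : Measure (EuclideanSpace ℂ (Fin (N + 1))) :=
  (volume : Measure (Fin (N + 1) → ℂ)).map (WithLp.toLp 2)

instance : (euclideanVolume N).IsAddHaarMeasure :=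
  ContinuousLinearEquiv.isAddHaarMeasure_map
    (PiLp.continuousLinearEquiv 2 ℝ (fun _ : Fin (N + 1) => ℂ)).symm volume

theorem finrank_euclideanSpace_complex :
    Module.finrank ℝ (EuclideanSpace ℂ (Fin (N + 1))) = 2 * (N + 1) := by
  rw [finrank_real_of_complex, finrank_euclideanSpace, Fintype.card_fin]

/-- Unitary maps preserve Lebesgue measure: the image is a Haar measure that agrees with it on the
unit ball. -/
theorem measurePreserving_linearIsometryEquiv
    (U : EuclideanSpace ℂ (Fin (N + 1)) ≃ₗᵢ[ℂ] EuclideanSpace ℂ (Fin (N + 1))) :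
    MeasurePreserving U (euclideanVolume N) (euclideanVolume N) := by
  refine ⟨U.continuous.measurable, ?_⟩
  have hhaar : ((euclideanVolume N).map U).IsAddHaarMeasure :=
    ContinuousLinearEquiv.isAddHaarMeasure_map
      (U.toContinuousLinearEquiv.restrictScalars ℝ) (euclideanVolume N)
  have hsmul := Measure.isAddLeftInvariant_eq_smul ((euclideanVolume N).map U) (euclideanVolume N)
  have hball : (euclideanVolume N).map U (Metric.ball 0 1) =
      euclideanVolume N (Metric.ball 0 1) := by
    rw [Measure.map_apply U.continuous.measurable measurableSet_ball]
    congr 1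
    ext x
    simp
  rw [hsmul, Measure.smul_apply] at hball
  have hfactor :
      Measure.addHaarScalarFactor ((euclideanVolume N).map U) (euclideanVolume N) = 1 := by
    have h0 : euclideanVolume N (Metric.ball 0 1) ≠ 0 :=
      (Metric.measure_ball_pos _ _ one_pos).ne'
    have h1 : euclideanVolume N (Metric.ball 0 1) ≠ ⊤ := measure_ball_lt_top.ne
    rw [ENNReal.smul_def, smul_eq_mul] at hball
    have := (ENNReal.mul_eq_right h0 h1).mp hball
    exact_mod_cast this
  rw [hsmul, hfactor, one_smul]

theorem integral_euclideanVolume (f : EuclideanSpace ℂ (Fin (N + 1)) → ℝ) :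
    ∫ x, f x ∂(euclideanVolume N) = ∫ y : Fin (N + 1) → ℂ, f (WithLp.toLp 2 y) :=
  integral_map_equiv (MeasurableEquiv.toLp 2 (Fin (N + 1) → ℂ)) f

theorem integrable_euclideanVolume_iff (f : EuclideanSpace ℂ (Fin (N + 1)) → ℝ) :
    Integrable f (euclideanVolume N) ↔
      Integrable (fun y : Fin (N + 1) → ℂ => f (WithLp.toLp 2 y)) :=
  integrable_map_equiv (MeasurableEquiv.toLp 2 (Fin (N + 1) → ℂ)) f

theorem integrable_gaussian :
    Integrable (fun x => Real.exp (-‖x‖ ^ 2)) (euclideanVolume N) :=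
  integrable_exp_neg_norm_sq _ finrank_euclideanSpace_complex

/-- The Gaussian weight splits as a product over the coordinates, and only the coordinate that
occurs in the logarithm carries another factor. -/
theorem log_norm_coord_mul_exp_eq_prod (y : Fin (N + 1) → ℂ) :
    Real.log ‖y 0‖ * Real.exp (-‖WithLp.toLp 2 y‖ ^ 2) =
      ∏ i, (if i = 0 then fun w : ℂ => Real.log ‖w‖ * Real.exp (-‖w‖ ^ 2)
        else fun w : ℂ => Real.exp (-‖w‖ ^ 2)) (y i) := by
  rw [EuclideanSpace.norm_sq_eq, ← Finset.sum_neg_distrib, Real.exp_sum, Fin.prod_univ_succ,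
    Fin.prod_univ_succ]
  simp [Fin.succ_ne_zero, mul_assoc]

theorem exp_neg_norm_sq_eq_prod (y : Fin (N + 1) → ℂ) :
    Real.exp (-‖WithLp.toLp 2 y‖ ^ 2) = ∏ i, Real.exp (-‖y i‖ ^ 2) := by
  rw [EuclideanSpace.norm_sq_eq, ← Finset.sum_neg_distrib, Real.exp_sum]

theorem finrank_complex_eq : Module.finrank ℝ ℂ = 2 * (0 + 1) := by
  rw [Complex.finrank_real_complex]

theorem integrable_log_norm_coord :
    Integrable (fun x => Real.log ‖x 0‖ * Real.exp (-‖x‖ ^ 2)) (euclideanVolume N) := by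
  rw [integrable_euclideanVolume_iff]
  simp only [log_norm_coord_mul_exp_eq_prod]
  refine Integrable.fintype_prod (f := fun i : Fin (N + 1) =>
    if i = 0 then fun w : ℂ => Real.log ‖w‖ * Real.exp (-‖w‖ ^ 2)
      else fun w : ℂ => Real.exp (-‖w‖ ^ 2)) fun i => ?_
  split_ifs
  · exact integrable_log_norm_mul_exp_neg_norm_sq volume finrank_complex_eq
  · exact integrable_exp_neg_norm_sq volume finrank_complex_eq

theorem integral_log_norm_coord :
    ∫ x, Real.log ‖x 0‖ * Real.exp (-‖x‖ ^ 2) ∂(euclideanVolume N) =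
      1 / 2 * (-eulerMascheroniConstant) * ∫ x, Real.exp (-‖x‖ ^ 2) ∂(euclideanVolume N) := by
  rw [integral_euclideanVolume, integral_euclideanVolume]
  simp only [log_norm_coord_mul_exp_eq_prod]
  simp only [exp_neg_norm_sq_eq_prod]
  rw [integral_fintype_prod_volume_eq_prod (fun i : Fin (N + 1) =>
    if i = 0 then fun w : ℂ => Real.log ‖w‖ * Real.exp (-‖w‖ ^ 2)
      else fun w : ℂ => Real.exp (-‖w‖ ^ 2)),
    integral_fintype_prod_volume_eq_prod (fun (_ : Fin (N + 1)) (w : ℂ) => Real.exp (-‖w‖ ^ 2)),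
    Fin.prod_univ_succ, Fin.prod_univ_succ]
  have := integral_log_norm_mul_exp_neg_norm_sq (volume : Measure ℂ) finrank_complex_eq
  simp only [Fin.succ_ne_zero, if_true, if_false, this]
  simp [mul_assoc]

/-- A nonzero linear form is, up to its norm, the first coordinate after a unitary change of
coordinates. -/
theorem exists_linearIsometryEquiv_coord {q : Fin (N + 1) → ℂ} (hq : q ≠ 0) :
    ∃ U : EuclideanSpace ℂ (Fin (N + 1)) ≃ₗᵢ[ℂ] EuclideanSpace ℂ (Fin (N + 1)),
      ∀ x, ∑ j, q j * x j = ‖WithLp.toLp 2 q‖ * U x 0 := by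
  let p : EuclideanSpace ℂ (Fin (N + 1)) := WithLp.toLp 2 fun j => star (q j)
  have hnorm : ‖p‖ = ‖WithLp.toLp 2 q‖ := by
    simp [p, EuclideanSpace.norm_eq]
  have hpos : ‖WithLp.toLp 2 q‖ ≠ 0 := by simpa using hq
  let e : EuclideanSpace ℂ (Fin (N + 1)) := ((‖p‖ : ℂ)⁻¹) • p
  have he : ‖e‖ = 1 := by
    simp only [e, norm_smul, norm_inv, Complex.norm_real, norm_norm]
    rw [hnorm]
    exact inv_mul_cancel₀ hpos
  have horth : Orthonormal ℂ (({0} : Set (Fin (N + 1))).domRestrict fun _ => e) :=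
    ⟨fun _ => he, fun i j hij => (hij (Subsingleton.elim i j)).elim⟩
  obtain ⟨b, hb⟩ := horth.exists_orthonormalBasis_extension_of_card_eq
    (by rw [finrank_euclideanSpace])
  refine ⟨b.repr, fun x => ?_⟩
  rw [b.repr_apply_apply, hb 0 rfl, inner_smul_left, ← hnorm]
  have hp : (‖p‖ : ℂ) ≠ 0 := by
    rw [hnorm]
    exact_mod_cast hpos
  rw [map_inv₀, Complex.conj_ofReal, mul_inv_cancel_left₀ hp, PiLp.inner_apply]
  simp [p, mul_comm]

theorem ae_linForm_ne_zero {q : Fin (N + 1) → ℂ} (hq : q ≠ 0) :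
    ∀ᵐ x ∂(euclideanVolume N), ∑ j, q j * x j ≠ 0 := by
  let L : EuclideanSpace ℂ (Fin (N + 1)) →ₗ[ℝ] ℂ :=
    { toFun := fun x => ∑ j, q j * x j
      map_add' := fun x y => by simp [mul_add, Finset.sum_add_distrib]
      map_smul' := fun r x => by
        simp only [PiLp.smul_apply, Complex.real_smul, RingHom.id_apply, Finset.mul_sum]
        exact Finset.sum_congr rfl fun j _ => by ring }
  have hL : LinearMap.ker L ≠ ⊤ := by
    intro h
    refine hq (funext fun k => ?_)
    have : EuclideanSpace.single k (1 : ℂ) ∈ LinearMap.ker L := h ▸ Submodule.mem_top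
    simpa [L, PiLp.single_apply] using this
  have := Measure.addHaar_submodule (euclideanVolume N) _ hL
  rw [ae_iff]
  convert this using 2
  ext x
  simp [L]

theorem log_norm_linForm_ae_eq {q : Fin (N + 1) → ℂ} (hq : q ≠ 0)
    {U : EuclideanSpace ℂ (Fin (N + 1)) ≃ₗᵢ[ℂ] EuclideanSpace ℂ (Fin (N + 1))}
    (hU : ∀ x, ∑ j, q j * x j = ‖WithLp.toLp 2 q‖ * U x 0) :
    (fun x => Real.log ‖∑ j, q j * x j‖ * Real.exp (-‖x‖ ^ 2)) =ᵐ[euclideanVolume N]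
      fun x => Real.log ‖WithLp.toLp 2 q‖ * Real.exp (-‖x‖ ^ 2) +
        Real.log ‖U x 0‖ * Real.exp (-‖U x‖ ^ 2) := by
  filter_upwards [ae_linForm_ne_zero hq] with x hx
  rw [hU] at hx ⊢
  rw [norm_mul, Complex.norm_real, norm_norm, Real.log_mul, U.norm_map, add_mul]
  · simpa using hq
  · exact norm_ne_zero_iff.mpr (right_ne_zero_of_mul hx)

theorem integrable_log_norm_linForm {q : Fin (N + 1) → ℂ} (hq : q ≠ 0) :
    Integrable (fun x => Real.log ‖∑ j, q j * x j‖ * Real.exp (-‖x‖ ^ 2)) (euclideanVolume N) := by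
  obtain ⟨U, hU⟩ := exists_linearIsometryEquiv_coord hq
  refine Integrable.congr ?_ (log_norm_linForm_ae_eq hq hU).symm
  exact (integrable_gaussian.const_mul _).add
    ((measurePreserving_linearIsometryEquiv U).integrable_comp_of_integrable
      integrable_log_norm_coord)

theorem integral_log_norm_linForm {q : Fin (N + 1) → ℂ} (hq : q ≠ 0) :
    ∫ x, Real.log ‖∑ j, q j * x j‖ * Real.exp (-‖x‖ ^ 2) ∂(euclideanVolume N) =
      (Real.log ‖WithLp.toLp 2 q‖ - 1 / 2 * eulerMascheroniConstant) *
        ∫ x, Real.exp (-‖x‖ ^ 2) ∂(euclideanVolume N) := by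
  obtain ⟨U, hU⟩ := exists_linearIsometryEquiv_coord hq
  have hUm := measurePreserving_linearIsometryEquiv U
  have hint : Integrable (fun x => Real.log ‖U x 0‖ * Real.exp (-‖U x‖ ^ 2)) (euclideanVolume N) :=
    hUm.integrable_comp_of_integrable integrable_log_norm_coord
  have hcomp := hUm.integral_comp U.toHomeomorph.measurableEmbedding
    (fun x => Real.log ‖x 0‖ * Real.exp (-‖x‖ ^ 2))
  rw [integral_congr_ae (log_norm_linForm_ae_eq hq hU),
    integral_add (integrable_gaussian.const_mul _) hint, integral_const_mul, hcomp,
    integral_log_norm_coord]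
  ring

/-- The logarithm of a product of linear forms, averaged over the sphere. The constant
`eulerMascheroniConstant` of the Gaussian means cancels between the forms and the powers of
`‖x‖`. -/
theorem average_log_norm_eval_prod_linForm {c : ℂ} (hc : c ≠ 0)
    {q : Fin (N + 1) → Fin (N + 1) → ℂ} (hq : ∀ i, q i ≠ 0) :
    (⨍ x, Real.log ‖eval (fun i => x.1 i) (C c * ∏ i, linForm (q i))‖ ∂(sphereMeasure N)) =
      Real.log ‖c‖ + ∑ i, Real.log ‖WithLp.toLp 2 (q i)‖ -
        1 / 2 * (N + 1) * (harmonic N : ℝ) := by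
  -- the logarithm of the quotient, unlike a difference of logarithms, is constant on rays also at
  -- the zeros of the form, where the real logarithm takes the value `log 0 = 0`
  let h : EuclideanSpace ℂ (Fin (N + 1)) → ℝ := fun x =>
    Real.log (‖c * ∏ i, ∑ j, q i j * x j‖ / ‖x‖ ^ (N + 1))
  have hsphere (x : Metric.sphere (0 : EuclideanSpace ℂ (Fin (N + 1))) 1) :
      Real.log ‖eval (fun i => x.1 i) (C c * ∏ i, linForm (q i))‖ = h x.1 := by
    simp [h, eval_linForm]
  have hray (x : EuclideanSpace ℂ (Fin (N + 1))) (r : ℝ) (hr : 0 < r) : h (r • x) = h x := by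
    have hl (i : Fin (N + 1)) : ∑ j, q i j * (r • x) j = r * ∑ j, q i j * x j := by
      simp only [PiLp.smul_apply, Complex.real_smul, Finset.mul_sum]
      exact Finset.sum_congr rfl fun j _ => by ring
    simp only [h, hl, Finset.prod_mul_distrib, Finset.prod_const, Finset.card_univ,
      Fintype.card_fin, norm_mul, norm_pow, norm_smul, Complex.norm_real, mul_pow]
    rw [mul_left_comm, mul_div_mul_left]
    exact pow_ne_zero _ (norm_ne_zero_iff.mpr hr.ne')
  have hae : (fun x => h x * Real.exp (-‖x‖ ^ 2)) =ᵐ[euclideanVolume N] fun x =>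
      Real.log ‖c‖ * Real.exp (-‖x‖ ^ 2) +
        ∑ i, Real.log ‖∑ j, q i j * x j‖ * Real.exp (-‖x‖ ^ 2) -
          (N + 1) * (Real.log ‖x‖ * Real.exp (-‖x‖ ^ 2)) := by
    have hall : ∀ᵐ x ∂(euclideanVolume N), ∀ i, ∑ j, q i j * x j ≠ 0 :=
      ae_all_iff.mpr fun i => ae_linForm_ne_zero (hq i)
    filter_upwards [hall] with x hx
    have hx0 : ‖x‖ ≠ 0 := by
      intro hx0
      rw [norm_eq_zero] at hx0
      exact hx 0 (by simp [hx0])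
    have hprod : ∀ i ∈ Finset.univ, ‖∑ j, q i j * x j‖ ≠ 0 := fun i _ =>
      norm_ne_zero_iff.mpr (hx i)
    simp only [h]
    rw [norm_mul, norm_prod, Real.log_div (mul_ne_zero (norm_ne_zero_iff.mpr hc)
      (Finset.prod_ne_zero_iff.mpr hprod)) (pow_ne_zero _ hx0), Real.log_mul
      (norm_ne_zero_iff.mpr hc) (Finset.prod_ne_zero_iff.mpr hprod), Real.log_prod hprod,
      Real.log_pow, ← Finset.sum_mul]
    push_cast
    ring
  have hZ : 0 < ∫ x, Real.exp (-‖x‖ ^ 2) ∂(euclideanVolume N) :=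
    integral_exp_pos integrable_gaussian
  have hlogint := integrable_log_norm_mul_exp_neg_norm_sq (euclideanVolume N)
    (finrank_euclideanSpace_complex (N := N))
  simp_rw [hsphere]
  refine (average_toSphere_eq (euclideanVolume N) finrank_euclideanSpace_complex hray).trans ?_
  have hsum : Integrable (fun x => ∑ i, Real.log ‖∑ j, q i j * x j‖ * Real.exp (-‖x‖ ^ 2))
      (euclideanVolume N) :=
    integrable_finsetSum _ fun i _ => integrable_log_norm_linForm (hq i)
  have hc' := (integrable_gaussian (N := N)).const_mul (Real.log ‖c‖)
  have hadd : Integrable (fun x => Real.log ‖c‖ * Real.exp (-‖x‖ ^ 2) +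
      ∑ i, Real.log ‖∑ j, q i j * x j‖ * Real.exp (-‖x‖ ^ 2)) (euclideanVolume N) := hc'.add hsum
  rw [integral_congr_ae hae, integral_sub hadd (hlogint.const_mul _), integral_add hc' hsum,
    integral_const_mul, integral_const_mul,
    integral_finsetSum _ fun i _ => integrable_log_norm_linForm (hq i),
    integral_log_norm_mul_exp_neg_norm_sq _ finrank_euclideanSpace_complex]
  simp_rw [fun i => integral_log_norm_linForm (hq i)]
  rw [← Finset.sum_mul, Finset.sum_sub_distrib, Finset.sum_const, Finset.card_univ,
    Fintype.card_fin, nsmul_eq_mul]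
  field_simp
  push_cast
  ring

end SphereAverage

/-! ### Hadamard's inequality and its case of equality -/

section Hadamard

open InnerProductSpace

variable {n : ℕ}

theorem det_of_eq_basisFun_det (q : Fin n → EuclideanSpace ℂ (Fin n)) :
    (Matrix.of fun i j => q j i).det = (EuclideanSpace.basisFun (Fin n) ℂ).toBasis.det q := by
  rw [Module.Basis.det_apply]
  congr 1

theorem norm_basisFun_det_eq (b : OrthonormalBasis (Fin n) ℂ (EuclideanSpace ℂ (Fin n)))
    (q : Fin n → EuclideanSpace ℂ (Fin n)) :
    ‖(EuclideanSpace.basisFun (Fin n) ℂ).toBasis.det q‖ = ‖b.toBasis.det q‖ := by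
  have h2 : (EuclideanSpace.basisFun (Fin n) ℂ).toBasis.det q =
      (EuclideanSpace.basisFun (Fin n) ℂ).toBasis.det b.toBasis * b.toBasis.det q := by
    rw [Module.Basis.det_apply, Module.Basis.det_apply, Module.Basis.det_apply, ← Matrix.det_mul,
      Module.Basis.toMatrix_mul_toMatrix]
  have h3 : ‖(EuclideanSpace.basisFun (Fin n) ℂ).toBasis.det b.toBasis‖ = 1 := by
    rw [b.coe_toBasis]
    exact (EuclideanSpace.basisFun (Fin n) ℂ).det_to_matrix_orthonormalBasis b
  rw [h2, norm_mul, h3, one_mul]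

/-- The matrix of a family in its Gram–Schmidt basis is triangular. -/
theorem norm_det_eq_prod_norm_inner_gramSchmidt (q : Fin n → EuclideanSpace ℂ (Fin n)) :
    ‖(Matrix.of fun i j => q j i).det‖ =
      ∏ i, ‖inner ℂ (gramSchmidtOrthonormalBasis (finrank_euclideanSpace) q i) (q i)‖ := by
  rw [det_of_eq_basisFun_det, norm_basisFun_det_eq
    (gramSchmidtOrthonormalBasis (𝕜 := ℂ) finrank_euclideanSpace q), ← norm_prod]
  exact congrArg norm (gramSchmidtOrthonormalBasis_det _ q)

theorem norm_det_le_prod_norm (q : Fin n → EuclideanSpace ℂ (Fin n)) :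
    ‖(Matrix.of fun i j => q j i).det‖ ≤ ∏ i, ‖q i‖ := by
  rw [norm_det_eq_prod_norm_inner_gramSchmidt]
  refine Finset.prod_le_prod (fun _ _ => norm_nonneg _) fun i _ => ?_
  refine (norm_inner_le_norm _ _).trans_eq ?_
  rw [OrthonormalBasis.norm_eq_one, one_mul]

/-- Equality in Hadamard's inequality characterizes orthogonal families: by the case of equality in
the Cauchy–Schwarz inequality, every vector is then a multiple of the corresponding vector of the
Gram–Schmidt basis. -/
theorem norm_det_eq_prod_norm_iff {q : Fin n → EuclideanSpace ℂ (Fin n)}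
    (hq : (Matrix.of fun i j => q j i).det ≠ 0) :
    ‖(Matrix.of fun i j => q j i).det‖ = ∏ i, ‖q i‖ ↔
      Pairwise fun i j => inner ℂ (q i) (q j) = 0 := by
  have hne (i : Fin n) : q i ≠ 0 := fun h =>
    hq (Matrix.det_eq_zero_of_column_eq_zero i fun k => by simp [h])
  constructor
  · intro heq
    obtain ⟨b, hb⟩ : ∃ b : OrthonormalBasis (Fin n) ℂ (EuclideanSpace ℂ (Fin n)),
        ‖(Matrix.of fun i j => q j i).det‖ = ∏ i, ‖inner ℂ (b i) (q i)‖ :=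
      ⟨_, norm_det_eq_prod_norm_inner_gramSchmidt q⟩
    have hpos : 0 < ∏ i, ‖inner ℂ (b i) (q i)‖ := by
      rw [← hb]
      exact norm_pos_iff.mpr hq
    rw [hb] at heq
    have hle (i : Fin n) : ‖inner ℂ (b i) (q i)‖ ≤ ‖q i‖ := by
      refine (norm_inner_le_norm _ _).trans_eq ?_
      rw [b.norm_eq_one, one_mul]
    have hCS (i : Fin n) : ‖inner ℂ (b i) (q i)‖ = ‖b i‖ * ‖q i‖ := by
      rw [b.norm_eq_one, one_mul]
      by_contra hi
      refine absurd heq (ne_of_lt ?_)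
      refine Finset.prod_lt_prod (fun j hj => ?_) (fun j _ => hle j)
        ⟨i, Finset.mem_univ i, lt_of_le_of_ne (hle i) hi⟩
      exact lt_of_le_of_ne (norm_nonneg _) (Finset.prod_ne_zero_iff.mp hpos.ne' j hj).symm
    have hmul (i : Fin n) : ∃ r : ℂ, q i = r • b i := by
      have hbi : b i ≠ 0 := norm_ne_zero_iff.mp (by rw [b.norm_eq_one]; exact one_ne_zero)
      obtain ⟨r, -, hr⟩ := (norm_inner_eq_norm_iff hbi (hne i)).mp (hCS i)
      exact ⟨r, hr⟩
    intro i j hij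
    obtain ⟨r, hr⟩ := hmul i
    obtain ⟨t, ht⟩ := hmul j
    rw [hr, ht, inner_smul_left, inner_smul_right, b.inner_eq_zero hij, mul_zero, mul_zero]
  · intro horth
    rw [norm_det_eq_prod_norm_inner_gramSchmidt]
    refine Finset.prod_congr rfl fun i _ => ?_
    rw [gramSchmidtOrthonormalBasis_apply_of_orthogonal _ horth (hne i), inner_smul_left,
      inner_self_eq_norm_sq_to_K]
    have := norm_ne_zero_iff.mpr (hne i)
    simp
    field_simp

end Hadamard

/-! ### Archimedean places -/

section InfinitePlaces

variable {K : Type*} [Field K] {N : ℕ}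

/-- The archimedean contribution is, up to a constant, the logarithm of the defect in Hadamard's
inequality for the transformed vectors. -/
theorem termInfinite_eq
    {P : Fin (N + 1) → ℙ (AlgebraicClosure K) (Fin (N + 1) → AlgebraicClosure K)}
    (hP : Projectivization.Independent P)
    {z : MvPolynomial (Fin (N + 1)) K} (hz : IsChowPoint P z)
    {m : ℕ} {s : MvPolynomial (MultiIndex N (N + 1)) K} (hm : 0 < m) (hs : s.IsHomogeneous m)
    (hinv : IsInvariant s) (ha : evalSection (RingHom.id K) s (coordForm K N) ≠ 0)
    {φ : K →+* ℂ} {τ : AlgebraicClosure K →+* ℂ}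
    (hτ : τ.comp (algebraMap K (AlgebraicClosure K)) = φ)
    (g : Matrix.SpecialLinearGroup (Fin (N + 1)) ℂ) :
    termInfinite φ m s z g =
      -Real.log ‖φ (evalSection (RingHom.id K) s (coordForm K N))‖ / m +
        (Real.log (∏ i, ‖imageVector τ g (P i)‖) -
          Real.log ‖(Matrix.of fun i j => imageVector τ g (P j) i).det‖) := by
  set a := evalSection (RingHom.id K) s (coordForm K N)
  obtain ⟨c, hc, hz⟩ := hz
  have hcol (j : Fin (N + 1)) : imageVector τ g (P j) =
      WithLp.toLp 2 fun i => (g.1 * (pointMatrix P).map τ) i j := rfl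
  have hof : (Matrix.of fun i j => imageVector τ g (P j) i) = g.1 * (pointMatrix P).map τ := rfl
  have hdet : (g.1 * (pointMatrix P).map τ).det = τ (pointMatrix P).det := by
    rw [Matrix.det_mul, g.2, one_mul]
    exact (τ.map_det _).symm
  have hdet0 : τ (pointMatrix P).det ≠ 0 := by
    simpa using det_pointMatrix_ne_zero hP
  have hcol0 (j : Fin (N + 1)) : (fun i => (g.1 * (pointMatrix P).map τ) i j) ≠ 0 := fun h =>
    hdet0 (by rw [← hdet]; exact Matrix.det_eq_zero_of_column_eq_zero j (congrFun h))
  have hτc : τ c ≠ 0 := by simpa using hc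
  have hφa : ‖φ a‖ ≠ 0 := by simpa using ha
  have hm' : (m : ℝ) ≠ 0 := by exact_mod_cast hm.ne'
  have hharm : ∑ j ∈ Finset.Icc 1 N, (1 / (j : ℝ)) = (harmonic N : ℝ) := by
    rw [harmonic_eq_sum_Icc]
    push_cast
    simp
  have hnorm : ∀ i ∈ Finset.univ, ‖imageVector τ g (P i)‖ ≠ 0 := fun i _ => by
    rw [hcol]
    simpa using hcol0 i
  rw [termInfinite, logNormChow, hinv.evalSection_act_chowPoint hz hs hτ,
    act_map_of_isChowPoint hz hτ, act_coordForm, average_log_norm_eval_prod_linForm hτc hcol0,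
    hharm, hof, hdet, norm_mul, norm_pow, norm_mul,
    Real.log_mul (pow_ne_zero _ (mul_ne_zero (norm_ne_zero_iff.mpr hτc)
      (norm_ne_zero_iff.mpr hdet0))) hφa, Real.log_pow,
    Real.log_mul (norm_ne_zero_iff.mpr hτc) (norm_ne_zero_iff.mpr hdet0),
    Real.log_prod hnorm]
  simp only [hcol]
  push_cast
  field_simp
  ring

theorem det_imageVector_ne_zero
    {P : Fin (N + 1) → ℙ (AlgebraicClosure K) (Fin (N + 1) → AlgebraicClosure K)}
    (hP : Projectivization.Independent P) (τ : AlgebraicClosure K →+* ℂ)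
    (g : Matrix.SpecialLinearGroup (Fin (N + 1)) ℂ) :
    (Matrix.of fun i j => imageVector τ g (P j) i).det ≠ 0 := by
  have hof : (Matrix.of fun i j => imageVector τ g (P j) i) = g.1 * (pointMatrix P).map τ := rfl
  have hdet : ((pointMatrix P).map τ).det = τ (pointMatrix P).det := (τ.map_det _).symm
  rw [hof, Matrix.det_mul, g.2, one_mul, hdet]
  simpa using det_pointMatrix_ne_zero hP

theorem le_termInfinite
    {P : Fin (N + 1) → ℙ (AlgebraicClosure K) (Fin (N + 1) → AlgebraicClosure K)}
    (hP : Projectivization.Independent P)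
    {z : MvPolynomial (Fin (N + 1)) K} (hz : IsChowPoint P z)
    {m : ℕ} {s : MvPolynomial (MultiIndex N (N + 1)) K} (hm : 0 < m) (hs : s.IsHomogeneous m)
    (hinv : IsInvariant s) (ha : evalSection (RingHom.id K) s (coordForm K N) ≠ 0)
    {φ : K →+* ℂ} {τ : AlgebraicClosure K →+* ℂ}
    (hτ : τ.comp (algebraMap K (AlgebraicClosure K)) = φ)
    (g : Matrix.SpecialLinearGroup (Fin (N + 1)) ℂ) :
    -Real.log ‖φ (evalSection (RingHom.id K) s (coordForm K N))‖ / m ≤ termInfinite φ m s z g := by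
  rw [termInfinite_eq hP hz hm hs hinv ha hτ]
  have := Real.log_le_log (norm_pos_iff.mpr (det_imageVector_ne_zero hP τ g))
    (norm_det_le_prod_norm fun i => imageVector τ g (P i))
  linarith

/-- The archimedean contribution takes the value of its lower bound exactly at the elements that
make the points orthogonal. -/
theorem termInfinite_eq_iff
    {P : Fin (N + 1) → ℙ (AlgebraicClosure K) (Fin (N + 1) → AlgebraicClosure K)}
    (hP : Projectivization.Independent P)
    {z : MvPolynomial (Fin (N + 1)) K} (hz : IsChowPoint P z)
    {m : ℕ} {s : MvPolynomial (MultiIndex N (N + 1)) K} (hm : 0 < m) (hs : s.IsHomogeneous m)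
    (hinv : IsInvariant s) (ha : evalSection (RingHom.id K) s (coordForm K N) ≠ 0)
    {φ : K →+* ℂ} {τ : AlgebraicClosure K →+* ℂ}
    (hτ : τ.comp (algebraMap K (AlgebraicClosure K)) = φ)
    (g : Matrix.SpecialLinearGroup (Fin (N + 1)) ℂ) :
    termInfinite φ m s z g = -Real.log ‖φ (evalSection (RingHom.id K) s (coordForm K N))‖ / m ↔
      Pairwise fun i j => inner ℂ (imageVector τ g (P i)) (imageVector τ g (P j)) = 0 := by
  have hdet := det_imageVector_ne_zero hP τ g
  have hpos := norm_pos_iff.mpr hdet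
  rw [termInfinite_eq hP hz hm hs hinv ha hτ, add_eq_left, sub_eq_zero, eq_comm,
    ← norm_det_eq_prod_norm_iff (q := fun i => imageVector τ g (P i)) hdet]
  exact Real.log_injOn_pos.eq_iff hpos
    (hpos.trans_le (norm_det_le_prod_norm fun i => imageVector τ g (P i)))

theorem exists_pairwise_inner_imageVector_eq_zero
    {P : Fin (N + 1) → ℙ (AlgebraicClosure K) (Fin (N + 1) → AlgebraicClosure K)}
    (hP : Projectivization.Independent P) (τ : AlgebraicClosure K →+* ℂ) :
    ∃ g : Matrix.SpecialLinearGroup (Fin (N + 1)) ℂ,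
      Pairwise fun i j => inner ℂ (imageVector τ g (P i)) (imageVector τ g (P j)) = 0 := by
  obtain ⟨g, δ, -, hg⟩ := exists_mul_pointMatrix_eq_smul_one hP τ
  refine ⟨g, fun i j hij => ?_⟩
  have hcol (j : Fin (N + 1)) : imageVector τ g (P j) = EuclideanSpace.single j δ := by
    have : imageVector τ g (P j) =
      WithLp.toLp 2 fun i => (g.1 * (pointMatrix P).map τ) i j := rfl
    rw [this, hg]
    ext i
    simp [Matrix.one_apply, PiLp.single_apply]
  simp only [hcol]
  rw [EuclideanSpace.inner_single_left, PiLp.single_apply, if_neg hij, mul_zero]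

/-- Every embedding of `K` into `ℂ` extends to the algebraic closure. -/
theorem exists_comp_algebraMap_eq (φ : K →+* ℂ) :
    ∃ τ : AlgebraicClosure K →+* ℂ, τ.comp (algebraMap K (AlgebraicClosure K)) = φ := by
  let := φ.toAlgebra
  exact ⟨(IsAlgClosed.lift : AlgebraicClosure K →ₐ[K] ℂ).toRingHom, AlgHom.comp_algebraMap _⟩

/-- The archimedean contribution attains its infimum. -/
theorem isLeast_range_termInfinite
    {P : Fin (N + 1) → ℙ (AlgebraicClosure K) (Fin (N + 1) → AlgebraicClosure K)}
    (hP : Projectivization.Independent P)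
    {z : MvPolynomial (Fin (N + 1)) K} (hz : IsChowPoint P z)
    {m : ℕ} {s : MvPolynomial (MultiIndex N (N + 1)) K} (hm : 0 < m) (hs : s.IsHomogeneous m)
    (hinv : IsInvariant s) (ha : evalSection (RingHom.id K) s (coordForm K N) ≠ 0)
    (φ : K →+* ℂ) :
    IsLeast (Set.range (termInfinite φ m s z))
      (-Real.log ‖φ (evalSection (RingHom.id K) s (coordForm K N))‖ / m) := by
  obtain ⟨τ, hτ⟩ := exists_comp_algebraMap_eq φ
  obtain ⟨g, hg⟩ := exists_pairwise_inner_imageVector_eq_zero hP τ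
  refine ⟨⟨g, (termInfinite_eq_iff hP hz hm hs hinv ha hτ g).mpr hg⟩, ?_⟩
  rintro _ ⟨h, rfl⟩
  exact le_termInfinite hP hz hm hs hinv ha hτ h

end InfinitePlaces

/-! ### The product formula -/

section ProductFormula

open IsDedekindDomain NumberField

variable {K : Type*} [Field K] [NumberField K]

theorem support_log_norm_embedding_finite {a : K} (ha : a ≠ 0) :
    (Function.support fun v : HeightOneSpectrum (𝓞 K) =>
      Real.log ‖FinitePlace.embedding v a‖).Finite := by
  have hfin := FinitePlace.hasFiniteMulSupport ha
  refine (hfin.image FinitePlace.equivHeightOneSpectrum).subset fun v hv => ?_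
  refine ⟨FinitePlace.equivHeightOneSpectrum.symm v, fun h => hv ?_, Equiv.apply_symm_apply _ v⟩
  simp only [FinitePlace.equivHeightOneSpectrum_symm_apply] at h
  simp only [h, Real.log_one]

/-- The product formula, in additive form. -/
theorem finsum_log_norm_embedding_add_sum_log {a : K} (ha : a ≠ 0) :
    (∑ᶠ v : HeightOneSpectrum (𝓞 K), Real.log ‖FinitePlace.embedding v a‖) +
      ∑ w : InfinitePlace K, (w.mult : ℝ) * Real.log ‖w.embedding a‖ = 0 := by
  have hfin : (Function.mulSupport fun w : FinitePlace K => w a).Finite :=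
    FinitePlace.hasFiniteMulSupport ha
  have hprod := prod_abs_eq_one ha
  have h1 : (∑ᶠ v : HeightOneSpectrum (𝓞 K), Real.log ‖FinitePlace.embedding v a‖) =
      ∑ᶠ w : FinitePlace K, Real.log (w a) := by
    rw [← finsum_comp_equiv FinitePlace.equivHeightOneSpectrum.symm]
    rfl
  have hsub : (Function.support fun w : FinitePlace K => Real.log (w a)) ⊆
      (hfin.toFinset : Set (FinitePlace K)) := fun w hw => by
    simp only [Set.Finite.coe_toFinset, Function.mem_mulSupport]
    intro h
    exact hw (by simp [h])
  have hpos (w : FinitePlace K) : w a ≠ 0 := (FinitePlace.pos_iff.mpr ha).ne'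
  have hpos' (w : InfinitePlace K) : w a ≠ 0 := (InfinitePlace.pos_iff.mpr ha).ne'
  have h2 : ∑ᶠ w : FinitePlace K, Real.log (w a) = Real.log (∏ᶠ w : FinitePlace K, w a) := by
    rw [finsum_eq_sum_of_support_subset _ hsub, finprod_eq_prod _ hfin,
      Real.log_prod fun w _ => hpos w]
  have h3 : ∑ w : InfinitePlace K, (w.mult : ℝ) * Real.log ‖w.embedding a‖ =
      Real.log (∏ w : InfinitePlace K, w a ^ w.mult) := by
    rw [Real.log_prod fun w _ => pow_ne_zero _ (hpos' w)]
    refine Finset.sum_congr rfl fun w _ => ?_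
    rw [Real.log_pow, InfinitePlace.norm_embedding_eq]
  have hne1 : ∏ w : InfinitePlace K, w a ^ w.mult ≠ 0 := left_ne_zero_of_mul_eq_one hprod
  have hne2 : ∏ᶠ w : FinitePlace K, w a ≠ 0 := right_ne_zero_of_mul_eq_one hprod
  rw [h1, h2, h3, add_comm, ← Real.log_mul hne1 hne2, hprod, Real.log_one]

end ProductFormula

/-- The value of an admissible section at the coordinate form does not vanish. -/
theorem IsAdmissible.evalSection_coordForm_ne_zero {K : Type*} [Field K] {N : ℕ}
    {P : Fin (N + 1) → ℙ (AlgebraicClosure K) (Fin (N + 1) → AlgebraicClosure K)}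
    (hP : Projectivization.Independent P)
    {z : MvPolynomial (Fin (N + 1)) K} (hz : IsChowPoint P z) {m : ℕ}
    {s : MvPolynomial (MultiIndex N (N + 1)) K} (hs : IsAdmissible z m s) :
    evalSection (RingHom.id K) s (coordForm K N) ≠ 0 := by
  exact (hs.invariant.evalSection_chowPoint_ne_zero_iff hP hz hs.homogeneous).mp hs.ne_zero

end ChowHeight

end

theorem mainTheorem3 {K : Type*} [Field K] [NumberField K] (N : ℕ)
    (P : Fin (N + 1) → ℙ (AlgebraicClosure K) (Fin (N + 1) → AlgebraicClosure K))
    (hP : Projectivization.Independent P)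
    (z : MvPolynomial (Fin (N + 1)) K) (hz : ChowHeight.IsChowPoint P z) :
    ChowHeight.IsSemistable (N + 1) z ∧
    ∀ (m : ℕ) (s : MvPolynomial (ChowHeight.MultiIndex N (N + 1)) K),
      ChowHeight.IsAdmissible z m s →
      (∀ v : IsDedekindDomain.HeightOneSpectrum (𝓞 K),
        BddBelow (Set.range (ChowHeight.termFinite v m s z))) ∧
      (∀ φ : K →+* ℂ, BddBelow (Set.range (ChowHeight.termInfinite φ m s z))) ∧
      (Function.support fun v : IsDedekindDomain.HeightOneSpectrum (𝓞 K) =>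
        ⨅ g, ChowHeight.termFinite v m s z g).Finite ∧
      ChowHeight.gitHeight m s z = 0 ∧
      ∀ (σ : AlgebraicClosure K →+* ℂ) (g : Matrix.SpecialLinearGroup (Fin (N + 1)) ℂ),
        (∀ h : Matrix.SpecialLinearGroup (Fin (N + 1)) ℂ,
          ChowHeight.termInfinite (σ.comp (algebraMap K (AlgebraicClosure K))) m s z g ≤
            ChowHeight.termInfinite (σ.comp (algebraMap K (AlgebraicClosure K))) m s z h) ↔
        Pairwise fun i j =>
          inner ℂ (ChowHeight.imageVector σ g (P i)) (ChowHeight.imageVector σ g (P j)) = 0 := by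
  refine ⟨ChowHeight.isSemistable_of_isChowPoint hP hz, fun m s hadm => ?_⟩
  have ha := hadm.evalSection_coordForm_ne_zero hP hz
  have hfin (v : IsDedekindDomain.HeightOneSpectrum (𝓞 K)) :=
    ChowHeight.isLeast_range_termFinite v hP hz hadm.pos hadm.homogeneous hadm.invariant ha
  have hinf (φ : K →+* ℂ) :=
    ChowHeight.isLeast_range_termInfinite hP hz hadm.pos hadm.homogeneous hadm.invariant ha φ
  set a := ChowHeight.evalSection (RingHom.id K) s (ChowHeight.coordForm K N)
  have hfin' (v : IsDedekindDomain.HeightOneSpectrum (𝓞 K)) :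
      ⨅ g, ChowHeight.termFinite v m s z g =
        -(m : ℝ)⁻¹ * Real.log ‖NumberField.FinitePlace.embedding v a‖ :=
    (hfin v).csInf_eq.trans (by ring)
  have hinf' (φ : K →+* ℂ) :
      ⨅ g, ChowHeight.termInfinite φ m s z g = -(m : ℝ)⁻¹ * Real.log ‖φ a‖ :=
    (hinf φ).csInf_eq.trans (by ring)
  refine ⟨fun v => (hfin v).bddBelow, fun φ => (hinf φ).bddBelow, ?_, ?_, fun σ g => ?_⟩
  · simp only [hfin']
    refine (ChowHeight.support_log_norm_embedding_finite ha).subset fun v hv => ?_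
    exact right_ne_zero_of_mul hv
  · rw [ChowHeight.gitHeight]
    simp only [hfin', hinf', mul_left_comm _ (-(m : ℝ)⁻¹)]
    rw [← mul_finsum, ← Finset.mul_sum,
      ← mul_add, ChowHeight.finsum_log_norm_embedding_add_sum_log ha, mul_zero, mul_zero]
  · rw [← ChowHeight.termInfinite_eq_iff hP hz hadm.pos hadm.homogeneous hadm.invariant ha rfl g]
    obtain ⟨⟨g₀, hg₀⟩, hle⟩ := hinf (σ.comp (algebraMap K (AlgebraicClosure K)))
    constructor
    · intro hmin
      exact le_antisymm ((hmin g₀).trans_eq hg₀) (hle ⟨g, rfl⟩)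
    · intro heq h
      rw [heq]
      exact hle ⟨h, rfl⟩
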